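/- **Spectrum on the imaginary axis for fourth-order equations.** Let $T>0$, let $S\subset\mathbb{C}$ be a finite (possibly empty) set with $-S=S$, and let $\mathbf{A}(x,\lambda)$ be a complex $4\times4$ matrix, defined for $x\in\mathbb{R}$ and $\lambda\in\mathbb{C}\setminus S$, jointly continuous in $(x,\lambda)$, holomorphic in $\lambda$, and $T$-periodic in $x$. Assume, for all $x\in\mathbb R$: * (A1) $\mathbf{A}(x,\lambda)$ is real for all $\lambda\in\mathbb{R}\setminus S$; * (A2) $\mathbf{A}^\top(x,\lambda)\mathbf{B}(\lambda)=-\mathbf{B}(\lambda)\mathbf{A}(x,-\lambda)$ for all $\lambda\in\mathbb{C}\setminus S$, for some matrix $\mathbf{B}(\lambda)$ that is independent of $x$ and nonsingular for all but at most finitely many $\lambda$; * $\operatorname{tr}\mathbf{A}(x,\lambda)=0$ for all $\lambda\in\mathbb{C}\setminus S$. Let $\mathbf{M}(\lambda)=\mathbf{V}(T,\lambda)$ be the monodromy matrix of $\mathbf{v}_x=\mathbf{A}(x,\lambda)\mathbf{v}$, where $\mathbf{V}_x=\mathbf{A}(x,\lambda)\mathbf{V}$ and $\mathbf{V}(0,\lambda)=\mathbf{I}_4$.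 The $L^2(\mathbb{R})$ essential spectrum is the set of those $\lambda$ for which the operator $\frac{d}{dx}-\mathbf{A}(\cdot,\lambda)$ on $L^2(\mathbb{R};\mathbb{C}^4)$, with domain $H^1(\mathbb{R};\mathbb{C}^4)$, is not Fredholm. The algebraic multiplicity of $\lambda$ in it is the dimension of the span of all solutions $\mathbf{v}$ of $\mathbf{v}_x=\mathbf{A}(x,\lambda)\mathbf{v}$ on $\mathbb{R}$ which, for some $\mu$ with $|\mu|=1$, are annihilated by some power of the map $\mathbf{v}\mapsto\mathbf{v}(\cdot+T)-\mu\mathbf{v}$ (Bloch waves and generalized Bloch waves). Then for every $\lambda\in i\mathbb{R}\setminus S$, the matrix $\mathbf{M}(\lambda)$ has $0$, $2$ or $4$ eigenvalues on the unit circle, counted by algebraic multiplicity. Moreover, there are real numbers $f_1,f_2,f_3$ (the Floquet discriminant at $\lambda$) with $$f_1+if_2=\operatorname{tr}\mathbf{M}(\lambda),\qquad f_3=\tfrac12\big((\operatorname{tr}\mathbf{M}(\lambda))^2-\operatorname{tr}(\mathbf{M}(\lambda)^2)\big).$$ Put $$\begin{aligned}\Delta_4={}&-4(f_1^6+f_2^6)-12f_1^2f_2^2(f_1^2+f_2^2)+(f_1^2+f_2^2)^2f_3^2+36(f_1^4-f_2^4)f_3-8(f_1^2-f_2^2)f_3^3\\&-60(f_1^4+f_2^4)+312f_1^2f_2^2+16f_3^4-80(f_1^2+f_2^2)f_3^2\\&+288(f_1^2-f_2^2)f_3-192(f_1^2+f_2^2)-128f_3^2+256,\\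 P_4={}&8(2f_1+f_3+2)(2f_3-12)-48f_2^2,\\ D_4={}&-256\big(4f_1^4+3f_2^4+f_1^2(4f_2^2+(-6+f_3)^2)+f_2^2(28+12f_3-f_3^2)+4f_1^3(2+f_3)\\&-4(-2+f_3)(2+f_3)^2+16f_1(4+2f_2^2-f_3^2)\big).\end{aligned}$$ If $\Delta_4$, $P_4$, $D_4$ are all nonzero, then: * if $\Delta_4>0$, $P_4<0$ and $D_4<0$, then $\lambda$ belongs to the essential spectrum with algebraic multiplicity $4$; * if $\Delta_4<0$, then $\lambda$ belongs to the essential spectrum with algebraic multiplicity $2$; * if $\Delta_4>0$ and ($P_4>0$ or $D_4>0$), then $\lambda$ has multiplicity $0$: it does not belong to the essential spectrum, and the dimension above is $0$. -/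

import Mathlib

open MeasureTheory
open scoped Matrix

noncomputable section

namespace Floquet

variable {n : ℕ}

/-- `V` is the fundamental matrix of `v' = A(x) v` normalized at `0`:
`V' = A V` on `ℝ` (entrywise) and `V(0) = I`. -/
def IsFundamentalMatrix (A V : ℝ → Matrix (Fin n) (Fin n) ℂ) : Prop :=
  V 0 = 1 ∧ ∀ x i j, HasDerivAt (fun y => V y i j) ((A x * V x) i j) x

/-- The number of eigenvalues of `M` on the unit circle, counted by algebraic multiplicity. -/
def unitCircleCount (M : Matrix (Fin n) (Fin n) ℂ) : ℕ :=
  open Classical in (M.charpoly.roots.filter (fun μ => ‖μ‖ = 1)).card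

/-- The Hilbert space `L²(ℝ; ℂⁿ)`. -/
abbrev L2 (n : ℕ) : Type := Lp (EuclideanSpace ℂ (Fin n)) 2 (volume : Measure ℝ)

/-- `u ∈ L²` has the derivative `w ∈ L²`, that is, `u` lies in the Sobolev space `H¹(ℝ; ℂⁿ)` and
`u' = w`: up to a null set, `u` is the locally absolutely continuous function
`x ↦ c + ∫₀ˣ w`. -/
def HasL2Deriv (u w : L2 n) : Prop :=
  ∃ c : EuclideanSpace ℂ (Fin n), ∀ᵐ x : ℝ, u x = c + ∫ s in (0 : ℝ)..x, w s

theorem intervalIntegrable_L2 (w : L2 n) (a b : ℝ) :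
    IntervalIntegrable (fun s => w s) volume a b := by
  have h : LocallyIntegrable (fun s => w s) volume :=
    (Lp.memLp w).locallyIntegrable (by norm_num)
  exact (h.integrableOn_isCompact isCompact_uIcc).intervalIntegrable

theorem HasL2Deriv.zero : HasL2Deriv (0 : L2 n) 0 := by
  refine ⟨0, ?_⟩
  have h := Lp.coeFn_zero (EuclideanSpace ℂ (Fin n)) 2 (volume : Measure ℝ)
  filter_upwards [h] with x hx
  have e : ∫ s in (0 : ℝ)..x, (0 : L2 n) s = ∫ _s in (0 : ℝ)..x, (0 : EuclideanSpace ℂ (Fin n)) :=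
    intervalIntegral.integral_congr_ae (by filter_upwards [h] with s hs _ using hs)
  rw [hx, e]
  simp

theorem HasL2Deriv.add {u w u' w' : L2 n} (h : HasL2Deriv u w) (h' : HasL2Deriv u' w') :
    HasL2Deriv (u + u') (w + w') := by
  obtain ⟨c, hc⟩ := h
  obtain ⟨c', hc'⟩ := h'
  refine ⟨c + c', ?_⟩
  filter_upwards [hc, hc', Lp.coeFn_add u u'] with x h1 h2 h3
  have e : ∫ s in (0 : ℝ)..x, (w + w') s = ∫ s in (0 : ℝ)..x, (w s + w' s) :=
    intervalIntegral.integral_congr_ae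
      (by filter_upwards [Lp.coeFn_add w w'] with s hs _ using hs)
  rw [h3, Pi.add_apply, h1, h2, e,
    intervalIntegral.integral_add (intervalIntegrable_L2 w _ _) (intervalIntegrable_L2 w' _ _)]
  abel

theorem HasL2Deriv.smul (a : ℂ) {u w : L2 n} (h : HasL2Deriv u w) :
    HasL2Deriv (a • u) (a • w) := by
  obtain ⟨c, hc⟩ := h
  refine ⟨a • c, ?_⟩
  filter_upwards [hc, Lp.coeFn_smul a u] with x h1 h3
  have e : ∫ s in (0 : ℝ)..x, (a • w) s = ∫ s in (0 : ℝ)..x, a • w s :=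
    intervalIntegral.integral_congr_ae
      (by filter_upwards [Lp.coeFn_smul a w] with s hs _ using hs)
  rw [h3, Pi.smul_apply, h1, e, intervalIntegral.integral_smul, smul_add]

/-- The graph of the operator `d/dx - A(x)` on `L²(ℝ; ℂⁿ)` with domain in `H¹(ℝ; ℂⁿ)`:
all pairs `(u, g)` in `L² × L²` with `u ∈ H¹` and `g = u' - A u`. -/
def opGraph (A : ℝ → Matrix (Fin n) (Fin n) ℂ) : Submodule ℂ (L2 n × L2 n) where
  carrier := {p | ∃ w : L2 n, HasL2Deriv p.1 w ∧
    ∀ᵐ x : ℝ, p.2 x = w x - WithLp.toLp 2 (A x *ᵥ (p.1 x).ofLp)}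
  zero_mem' := by
    refine ⟨0, HasL2Deriv.zero, ?_⟩
    filter_upwards [Lp.coeFn_zero (EuclideanSpace ℂ (Fin n)) 2 (volume : Measure ℝ)] with x hx
    simp
  add_mem' := by
    rintro ⟨u, g⟩ ⟨u', g'⟩ ⟨w, h1, h2⟩ ⟨w', h1', h2'⟩
    refine ⟨w + w', h1.add h1', ?_⟩
    filter_upwards [h2, h2', Lp.coeFn_add u u', Lp.coeFn_add g g', Lp.coeFn_add w w']
      with x e1 e2 e3 e4 e5
    simp only [Prod.mk_add_mk] at *
    rw [e4, e5, e3, Pi.add_apply, Pi.add_apply, Pi.add_apply, e1, e2, WithLp.ofLp_add,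
      Matrix.mulVec_add, WithLp.toLp_add]
    abel
  smul_mem' := by
    rintro a ⟨u, g⟩ ⟨w, h1, h2⟩
    refine ⟨a • w, h1.smul a, ?_⟩
    filter_upwards [h2, Lp.coeFn_smul a u, Lp.coeFn_smul a g, Lp.coeFn_smul a w]
      with x e1 e3 e4 e5
    simp only [Prod.smul_mk] at *
    rw [e4, e5, e3, Pi.smul_apply, Pi.smul_apply, Pi.smul_apply, e1, WithLp.ofLp_smul,
      Matrix.mulVec_smul, WithLp.toLp_smul, smul_sub]

/-- The kernel of `d/dx - A(x)` in `L²(ℝ; ℂⁿ)`. -/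
def opKer (A : ℝ → Matrix (Fin n) (Fin n) ℂ) : Submodule ℂ (L2 n) :=
  (opGraph A).comap (LinearMap.inl ℂ (L2 n) (L2 n))

/-- The range of `d/dx - A(x)` in `L²(ℝ; ℂⁿ)`. -/
def opRange (A : ℝ → Matrix (Fin n) (Fin n) ℂ) : Submodule ℂ (L2 n) :=
  (opGraph A).map (LinearMap.snd ℂ (L2 n) (L2 n))

/-- `d/dx - A(x)` is a Fredholm operator on `L²(ℝ; ℂⁿ)`: finite-dimensional kernel, closed range
of finite codimension. -/
def IsFredholm (A : ℝ → Matrix (Fin n) (Fin n) ℂ) : Prop :=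
  FiniteDimensional ℂ (opKer A) ∧ IsClosed (opRange A : Set (L2 n)) ∧
    FiniteDimensional ℂ (L2 n ⧸ opRange A)

/-- The `L²(ℝ)` essential spectrum of the spectral problem `v' = A(x, lam) v`: the values of `lam`
for which `d/dx - A(·, lam)` is not Fredholm on `L²(ℝ; ℂⁿ)`. -/
def essSpectrum (A : ℝ → ℂ → Matrix (Fin n) (Fin n) ℂ) : Set ℂ :=
  {lam | ¬ IsFredholm (fun x => A x lam)}

/-- The space of all solutions of `v' = A(x) v` on `ℝ`. -/
def solutionSpace (A : ℝ → Matrix (Fin n) (Fin n) ℂ) : Submodule ℂ (ℝ → Fin n → ℂ) where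
  carrier := {v | ∀ x, HasDerivAt v (A x *ᵥ v x) x}
  zero_mem' := fun x => by
    simp
  add_mem' := fun {v w} hv hw x => by
    simpa [Matrix.mulVec_add] using (hv x).add (hw x)
  smul_mem' := fun a v hv x => by
    simpa [Matrix.mulVec_smul] using (hv x).const_smul a

/-- The translation `v ↦ v(· + T)`. -/
def translation (n : ℕ) (T : ℝ) : Module.End ℂ (ℝ → Fin n → ℂ) where
  toFun v := fun x => v (x + T)
  map_add' _ _ := rfl
  map_smul' _ _ := rfl

/-- The algebraic multiplicity of `lam` in the essential spectrum of the `T`-periodic problem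
`v' = A(x, lam) v`: the dimension of the space spanned by the solutions that are Bloch waves
`v(x + T) = μ v(x)`, `|μ| = 1`, or generalized Bloch waves (annihilated by a power of
`v ↦ v(· + T) - μ v`). -/
def essMultiplicity (A : ℝ → ℂ → Matrix (Fin n) (Fin n) ℂ) (T : ℝ) (lam : ℂ) : ℕ :=
  Module.finrank ℂ
    (⨆ μ ∈ {μ : ℂ | ‖μ‖ = 1},
      (translation n T).maxGenEigenspace μ ⊓ solutionSpace (fun x => A x lam) :
      Submodule ℂ (ℝ → Fin n → ℂ))

def Delta4 (f₁ f₂ f₃ : ℝ) : ℝ :=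
  -4 * (f₁ ^ 6 + f₂ ^ 6) - 12 * f₁ ^ 2 * f₂ ^ 2 * (f₁ ^ 2 + f₂ ^ 2)
    + (f₁ ^ 2 + f₂ ^ 2) ^ 2 * f₃ ^ 2
    + 36 * (f₁ ^ 4 - f₂ ^ 4) * f₃ - 8 * (f₁ ^ 2 - f₂ ^ 2) * f₃ ^ 3
    - 60 * (f₁ ^ 4 + f₂ ^ 4) + 312 * f₁ ^ 2 * f₂ ^ 2 + 16 * f₃ ^ 4
    - 80 * (f₁ ^ 2 + f₂ ^ 2) * f₃ ^ 2
    + 288 * (f₁ ^ 2 - f₂ ^ 2) * f₃ - 192 * (f₁ ^ 2 + f₂ ^ 2) - 128 * f₃ ^ 2 + 256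

def P4 (f₁ f₂ f₃ : ℝ) : ℝ :=
  8 * (2 * f₁ + f₃ + 2) * (2 * f₃ - 12) - 48 * f₂ ^ 2

def D4 (f₁ f₂ f₃ : ℝ) : ℝ :=
  -256 * (4 * f₁ ^ 4 + 3 * f₂ ^ 4 + f₁ ^ 2 * (4 * f₂ ^ 2 + (-6 + f₃) ^ 2)
    + f₂ ^ 2 * (28 + 12 * f₃ - f₃ ^ 2) + 4 * f₁ ^ 3 * (2 + f₃)
    - 4 * (-2 + f₃) * (2 + f₃) ^ 2 + 16 * f₁ * (4 + 2 * f₂ ^ 2 - f₃ ^ 2))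

end Floquet

end

-- On the imaginary axis `conj lam = -lam`. By (A1) and Schwarz reflection, `A x (-lam)` is the
-- complex conjugate of `A x lam`, hence `V T (-lam)` is the conjugate of the monodromy matrix `M`
-- at `lam`. By (A2), `Vᵀ B V'` is conserved when `V'` is the fundamental matrix at `-lam`, so `V'`
-- has the spectrum of `V⁻¹` wherever `B` is nonsingular, and elsewhere by continuity in `lam`. The
-- multipliers at `lam` are therefore symmetric under `r ↦ 1 / conj r`
-- (`map_circleReflection_roots_charpoly`), and their product is 1 by Liouville's formula. Points
-- off the circle come in pairs, which leaves 0, 2 or 4 on it; the elementary symmetric functions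
-- satisfy `e₃ = conj e₁`, `e₂` real, `e₄ = 1`.
--
-- The signs are then a question about quartics (`card_circle_classification`). `Delta4` is the
-- discriminant, a product of squared differences: negative only for exactly one reflected pair. To
-- separate four points on the circle from two reflected pairs, a Cayley transform sends the circle
-- to the real line. `P4` and `D4` become, up to the factors `-A ^ 2` and `-A ^ 4` with `A` the
-- leading coefficient, the first two elementary symmetric functions of the squares of `y₁ + y₂ - y₃
-- - y₄` and its two companions. For real roots these squares are nonnegative. For two conjugate
-- pairs one is nonnegative and two are nonpositive, and then both symmetric functions cannot be
-- positive.
--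
-- Translation by the period acts on solutions as `M`, so the multiplicity is the number of
-- multipliers on the circle. For the spectrum itself: a Fredholm operator commuting with
-- translation is onto, because translation has no eigenvector in `L²`. A multiplier on the circle
-- gives a bounded adjoint solution, which obstructs surjectivity (`not_isFredholm_of_norm_eq_one`).
-- If no multiplier lies on the circle and all are simple (`Delta4 ≠ 0`), Floquet solutions form an
-- exponential dichotomy and variation of constants inverts the operator (`isFredholm_of_nodup`).

noncomputable section

-- Quartics symmetric about the unit circle: root counts from invariants.

namespace Floquet

open scoped ComplexConjugate

/-- Reflection in the unit circle. -/
def circleReflection (r : ℂ) : ℂ := (conj r)⁻¹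

theorem norm_circleReflection (r : ℂ) : ‖circleReflection r‖ = ‖r‖⁻¹ := by
  simp [circleReflection]

theorem circleReflection_of_norm_eq_one {r : ℂ} (h : ‖r‖ = 1) : circleReflection r = r := by
  have : r * conj r = 1 := by rw [Complex.mul_conj, Complex.normSq_eq_norm_sq, h]; simp
  exact (eq_inv_of_mul_eq_one_left this).symm

theorem mul_conj_of_norm_eq_one {r : ℂ} (h : ‖r‖ = 1) : conj r = r⁻¹ := by
  have : r * conj r = 1 := by rw [Complex.mul_conj, Complex.normSq_eq_norm_sq, h]; simp
  exact eq_inv_of_mul_eq_one_right this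

/-- A multiset symmetric about the unit circle consists of points on the circle and of pairs of
mutually reflected points off it. -/
theorem exists_eq_add_map_circleReflection {s : Multiset ℂ} (hs : s.map circleReflection = s)
    (h0 : (0 : ℂ) ∉ s) :
    ∃ C L : Multiset ℂ, s = C + (L + L.map circleReflection) ∧ (∀ r ∈ C, ‖r‖ = 1) ∧
      ∀ r ∈ L, r ≠ 0 ∧ ‖r‖ < 1 := by
  classical
  refine ⟨s.filter (fun r => ‖r‖ = 1), s.filter (fun r => ‖r‖ < 1), ?_, ?_, ?_⟩
  -- Reflection exchanges inside and outside with multiplicities, so the outer part is the image of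
  -- the inner one.
  · have e1 : (s.filter (fun r => ‖r‖ < 1)).map circleReflection
        = s.filter (fun r => 1 < ‖r‖) := by
      conv_rhs => rw [← hs]
      rw [Multiset.filter_map]
      congr 1
      refine Multiset.filter_congr fun r hr => ?_
      have : 0 < ‖r‖ := norm_pos_iff.2 (fun h => h0 (h ▸ hr))
      simp only [Function.comp, norm_circleReflection]
      rw [one_lt_inv₀ this]
    rw [e1]
    have e2 : s.filter (fun r => ¬ ‖r‖ = 1)
        = s.filter (fun r => ‖r‖ < 1) + s.filter (fun r => 1 < ‖r‖) := by
      rw [← Multiset.filter_add_not (fun r => ‖r‖ < 1) (s.filter (fun r => ¬ ‖r‖ = 1)),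
        Multiset.filter_filter, Multiset.filter_filter]
      congr 1
      · exact Multiset.filter_congr fun r _ => ⟨fun h => h.1, fun h => ⟨h, h.ne⟩⟩
      · exact Multiset.filter_congr fun r _ =>
          ⟨fun h => lt_of_le_of_ne (not_lt.1 h.1) (Ne.symm h.2), fun h => ⟨h.not_gt, h.ne'⟩⟩
    rw [← e2, Multiset.filter_add_not]
  · intro r hr
    exact (Multiset.mem_filter.1 hr).2
  · intro r hr
    exact ⟨fun h => h0 (h ▸ (Multiset.mem_filter.1 hr).1), (Multiset.mem_filter.1 hr).2⟩

theorem card_filter_norm_eq_one {C L : Multiset ℂ} (hC : ∀ r ∈ C, ‖r‖ = 1)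
    (hL : ∀ r ∈ L, r ≠ 0 ∧ ‖r‖ < 1) [DecidablePred fun r : ℂ => ‖r‖ = 1] :
    ((C + (L + L.map circleReflection)).filter (fun r => ‖r‖ = 1)).card = C.card := by
  rw [Multiset.filter_add, Multiset.filter_add, Multiset.filter_eq_self.2 hC,
    Multiset.filter_eq_nil.2 (fun r hr => (hL r hr).2.ne),
    Multiset.filter_eq_nil.2]
  · simp
  · intro r hr
    obtain ⟨t, ht, rfl⟩ := Multiset.mem_map.1 hr
    rw [norm_circleReflection, inv_eq_one]
    exact (hL t ht).2.ne

/-- The discriminant of the monic quartic with elementary symmetric functions `e₁, …, e₄` of its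
roots. -/
def quarticDisc (e₁ e₂ e₃ e₄ : ℂ) : ℂ :=
  256 * e₄ ^ 3 - 192 * e₁ * e₃ * e₄ ^ 2 - 128 * e₂ ^ 2 * e₄ ^ 2 + 144 * e₂ * e₃ ^ 2 * e₄
    - 27 * e₃ ^ 4 + 144 * e₁ ^ 2 * e₂ * e₄ ^ 2 - 6 * e₁ ^ 2 * e₃ ^ 2 * e₄
    - 80 * e₁ * e₂ ^ 2 * e₃ * e₄ + 18 * e₁ * e₂ * e₃ ^ 3 + 16 * e₂ ^ 4 * e₄
    - 4 * e₂ ^ 3 * e₃ ^ 2 - 27 * e₁ ^ 4 * e₄ ^ 2 + 18 * e₁ ^ 3 * e₂ * e₃ * e₄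
    - 4 * e₁ ^ 3 * e₃ ^ 3 - 4 * e₁ ^ 2 * e₂ ^ 3 * e₄ + e₁ ^ 2 * e₂ ^ 2 * e₃ ^ 2

theorem quarticDisc_eq_prod (a b c d : ℂ) :
    quarticDisc (a + b + c + d) (a * b + a * c + a * d + b * c + b * d + c * d)
      (a * b * c + a * b * d + a * c * d + b * c * d) (a * b * c * d)
      = ((a - b) * (a - c) * (a - d) * (b - c) * (b - d) * (c - d)) ^ 2 := by
  unfold quarticDisc
  ring

theorem Delta4_eq_quarticDisc {f₁ f₂ f₃ : ℝ} {e₁ e₃ : ℂ} (h1 : e₁ = f₁ + Complex.I * f₂)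
    (h3 : e₃ = f₁ - Complex.I * f₂) :
    (Delta4 f₁ f₂ f₃ : ℂ) = quarticDisc e₁ f₃ e₃ 1 := by
  -- `f₂` enters `Delta4` only in even powers, so `I` disappears on passing to `e₁` and `e₃`.
  have hf1 : (f₁ : ℂ) = (e₁ + e₃) / 2 := by rw [h1, h3]; ring
  have hf2 : (f₂ : ℂ) ^ 2 = -((e₁ - e₃) / 2) ^ 2 := by
    rw [h1, h3]; linear_combination ((f₂ : ℂ) ^ 2) * Complex.I_sq
  have hf4 : (f₂ : ℂ) ^ 4 = (-((e₁ - e₃) / 2) ^ 2) ^ 2 := by rw [← hf2]; ring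
  have hf6 : (f₂ : ℂ) ^ 6 = (-((e₁ - e₃) / 2) ^ 2) ^ 3 := by rw [← hf2]; ring
  unfold Delta4 quarticDisc
  push_cast
  rw [hf6, hf4, hf2, hf1]
  ring

/-- The data attached to four points with product `1` that are symmetric about the unit circle:
`f₁ + i f₂`, `f₃` and `f₁ - i f₂` are their elementary symmetric functions. -/
structure QuarticData (f₁ f₂ f₃ : ℝ) (a b c d : ℂ) : Prop where
  e₁ : a + b + c + d = f₁ + Complex.I * f₂
  e₂ : a * b + a * c + a * d + b * c + b * d + c * d = f₃
  e₃ : a * b * c + a * b * d + a * c * d + b * c * d = f₁ - Complex.I * f₂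
  e₄ : a * b * c * d = 1

namespace QuarticData

variable {f₁ f₂ f₃ : ℝ} {a b c d : ℂ}

theorem Delta4_eq (h : QuarticData f₁ f₂ f₃ a b c d) : (Delta4 f₁ f₂ f₃ : ℂ)
    = ((a - b) * (a - c) * (a - d) * (b - c) * (b - d) * (c - d)) ^ 2 := by
  rw [Delta4_eq_quarticDisc h.e₁ h.e₃, ← h.e₂, ← h.e₄, quarticDisc_eq_prod]

/-- On the circle `conj r = r⁻¹`, so `|r - s|² = (r - s) (r⁻¹ - s⁻¹)`. -/
theorem sq_sub_of_norm_eq_one {r s : ℂ} (hr : ‖r‖ = 1) (hs : ‖s‖ = 1) :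
    (r - s) ^ 2 = -((Complex.normSq (r - s) : ℝ) : ℂ) * (r * s) := by
  have hr0 : r ≠ 0 := norm_ne_zero_iff.1 (by simp [hr])
  have hs0 : s ≠ 0 := norm_ne_zero_iff.1 (by simp [hs])
  rw [← Complex.mul_conj, map_sub, mul_conj_of_norm_eq_one hr, mul_conj_of_norm_eq_one hs]
  field_simp
  ring

/-- Each of the six squared differences contributes a minus sign and a factor `r * s`. The signs
cancel, and each root occurs in three differences, so the factors multiply to `(a b c d) ^ 3 = 1`.
-/
theorem Delta4_nonneg_of_circle (h : QuarticData f₁ f₂ f₃ a b c d) (ha : ‖a‖ = 1) (hb : ‖b‖ = 1)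
    (hc : ‖c‖ = 1) (hd : ‖d‖ = 1) : 0 ≤ Delta4 f₁ f₂ f₃ := by
  have e : (Delta4 f₁ f₂ f₃ : ℂ) = ((Complex.normSq (a - b) * Complex.normSq (a - c)
      * Complex.normSq (a - d) * Complex.normSq (b - c) * Complex.normSq (b - d)
      * Complex.normSq (c - d) : ℝ) : ℂ) := by
    rw [h.Delta4_eq]
    simp only [mul_pow, sq_sub_of_norm_eq_one ha hb, sq_sub_of_norm_eq_one ha hc,
      sq_sub_of_norm_eq_one ha hd, sq_sub_of_norm_eq_one hb hc, sq_sub_of_norm_eq_one hb hd,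
      sq_sub_of_norm_eq_one hc hd]
    push_cast
    generalize ((Complex.normSq (a - b) : ℝ) : ℂ) = k₁
    generalize ((Complex.normSq (a - c) : ℝ) : ℂ) = k₂
    generalize ((Complex.normSq (a - d) : ℝ) : ℂ) = k₃
    generalize ((Complex.normSq (b - c) : ℝ) : ℂ) = k₄
    generalize ((Complex.normSq (b - d) : ℝ) : ℂ) = k₅
    generalize ((Complex.normSq (c - d) : ℝ) : ℂ) = k₆
    calc _ = k₁ * k₂ * k₃ * k₄ * k₅ * k₆ * (a * b * c * d) ^ 3 := by ring
      _ = _ := by rw [h.e₄]; ring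
  rw [Complex.ofReal_inj.1 e]
  simp only [Complex.normSq_eq_norm_sq]
  positivity

/-- The differences between a circle point and the reflected pair enter as squares of products, and
`(c - circleReflection c) ^ 2` is a nonnegative multiple of `c * circleReflection c`; the one
surviving sign comes from `(a - b) ^ 2`. -/
theorem Delta4_nonpos_of_two (h : QuarticData f₁ f₂ f₃ a b c (circleReflection c)) (ha : ‖a‖ = 1)
    (hb : ‖b‖ = 1) (hc : c ≠ 0) : Delta4 f₁ f₂ f₃ ≤ 0 := by
  have hc' : conj c ≠ 0 := by simpa using hc
  have ha0 : a ≠ 0 := norm_ne_zero_iff.1 (by simp [ha])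
  have hb0 : b ≠ 0 := norm_ne_zero_iff.1 (by simp [hb])
  have key : ∀ r : ℂ, ‖r‖ = 1 → (r - c) * (r - circleReflection c)
      = -((Complex.normSq (r - c) : ℝ) : ℂ) * (r * circleReflection c) := by
    intro r hr
    have hr0 : r ≠ 0 := norm_ne_zero_iff.1 (by simp [hr])
    rw [← Complex.mul_conj, map_sub, mul_conj_of_norm_eq_one hr, circleReflection]
    field_simp
    ring
  have key2 : (c - circleReflection c) ^ 2
      = (((Complex.normSq c - 1) ^ 2 : ℝ) : ℂ) * ((Complex.normSq c)⁻¹ : ℝ)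
        * (c * circleReflection c) := by
    push_cast
    rw [← Complex.mul_conj, circleReflection]
    field_simp
  have hab : a * b = conj c * c⁻¹ := by
    have := h.e₄
    rw [circleReflection] at this
    field_simp at this ⊢
    linear_combination this
  have e : (Delta4 f₁ f₂ f₃ : ℂ) = ((-(Complex.normSq (a - b) * Complex.normSq (a - c) ^ 2
      * Complex.normSq (b - c) ^ 2 * ((Complex.normSq c - 1) ^ 2 * (Complex.normSq c)⁻¹)
      * (Complex.normSq c)⁻¹ ^ 2) : ℝ) : ℂ) := by
    rw [h.Delta4_eq]
    have e1 : ((a - b) * (a - c) * (a - circleReflection c) * (b - c) * (b - circleReflection c)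
        * (c - circleReflection c)) ^ 2 = (a - b) ^ 2 * ((a - c) * (a - circleReflection c)) ^ 2
        * ((b - c) * (b - circleReflection c)) ^ 2 * (c - circleReflection c) ^ 2 := by ring
    rw [e1, key a ha, key b hb, key2, sq_sub_of_norm_eq_one ha hb]
    push_cast
    generalize ((Complex.normSq (a - b) : ℝ) : ℂ) = k₁
    generalize ((Complex.normSq (a - c) : ℝ) : ℂ) = k₂
    generalize ((Complex.normSq (b - c) : ℝ) : ℂ) = k₃
    generalize hk : ((Complex.normSq c : ℝ) : ℂ) - 1 = k₄
    -- The leftover root factors are grouped so that the first bracket is the product of all roots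
    -- and the second reduces to `1 / |c|²`.
    calc _ = -(k₁ * k₂ ^ 2 * k₃ ^ 2 * k₄ ^ 2 * ((Complex.normSq c : ℝ) : ℂ)⁻¹ *
          ((a * b * c * circleReflection c) * (a * b * circleReflection c ^ 2) ^ 2)) := by ring
      _ = _ := by
        rw [h.e₄, hab, ← Complex.mul_conj, circleReflection]
        field_simp
  rw [Complex.ofReal_inj.1 e]
  rw [neg_nonpos]
  simp only [Complex.normSq_eq_norm_sq]
  positivity

/-- Reflection permutes the four cross differences in two pairs; each pair has a product that is
real up to root factors and enters squared. The two remaining squared differences are nonnegative up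
to root factors, so no sign survives. -/
theorem Delta4_nonneg_of_zero
    (h : QuarticData f₁ f₂ f₃ a (circleReflection a) c (circleReflection c)) (ha : a ≠ 0)
    (hc : c ≠ 0) : 0 ≤ Delta4 f₁ f₂ f₃ := by
  have hc' : conj c ≠ 0 := by simpa using hc
  have ha' : conj a ≠ 0 := by simpa using ha
  have key2 : ∀ r : ℂ, r ≠ 0 → (r - circleReflection r) ^ 2
      = (((Complex.normSq r - 1) ^ 2 * (Complex.normSq r)⁻¹ : ℝ) : ℂ)
        * (r * circleReflection r) := by
    intro r hr
    have hr' : conj r ≠ 0 := by simpa using hr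
    push_cast
    rw [← Complex.mul_conj, circleReflection]
    field_simp
  have key3 : (a - c) * (circleReflection a - circleReflection c)
      = -((Complex.normSq (a - c) : ℝ) : ℂ) * (circleReflection a * circleReflection c) := by
    rw [← Complex.mul_conj, map_sub, circleReflection, circleReflection]
    field_simp
    ring
  have key4 : (a - circleReflection c) * (circleReflection a - c)
      = -((Complex.normSq (a - circleReflection c) : ℝ) : ℂ) * (c * circleReflection a) := by
    rw [← Complex.mul_conj, map_sub, circleReflection, circleReflection, map_inv₀,
      Complex.conj_conj]
    field_simp
    ring
  have e : (Delta4 f₁ f₂ f₃ : ℂ) = ((((Complex.normSq a - 1) ^ 2 * (Complex.normSq a)⁻¹)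
      * ((Complex.normSq c - 1) ^ 2 * (Complex.normSq c)⁻¹) * Complex.normSq (a - c) ^ 2
      * Complex.normSq (a - circleReflection c) ^ 2 * (Complex.normSq a)⁻¹ ^ 2 : ℝ) : ℂ) := by
    rw [h.Delta4_eq]
    have e1 : ((a - circleReflection a) * (a - c) * (a - circleReflection c)
        * (circleReflection a - c) * (circleReflection a - circleReflection c)
        * (c - circleReflection c)) ^ 2
        = (a - circleReflection a) ^ 2 * (c - circleReflection c) ^ 2
        * ((a - c) * (circleReflection a - circleReflection c)) ^ 2
        * ((a - circleReflection c) * (circleReflection a - c)) ^ 2 := by ring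
    rw [e1, key2 a ha, key2 c hc, key3, key4]
    have e2 : circleReflection a ^ 2 * (c * circleReflection c)
        = ((Complex.normSq a)⁻¹ : ℝ) := by
      have := h.e₄
      push_cast
      rw [← Complex.mul_conj]
      calc _ = (a * circleReflection a * c * circleReflection c) * circleReflection a * a⁻¹ := by
            field_simp
        _ = _ := by rw [this, circleReflection]; field_simp
    generalize (((Complex.normSq a - 1) ^ 2 * (Complex.normSq a)⁻¹) : ℝ) = k₁
    generalize (((Complex.normSq c - 1) ^ 2 * (Complex.normSq c)⁻¹) : ℝ) = k₂
    generalize (Complex.normSq (a - c)) = k₃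
    generalize (Complex.normSq (a - circleReflection c)) = k₄
    calc _ = (k₁ : ℂ) * k₂ * k₃ ^ 2 * k₄ ^ 2 * ((a * circleReflection a * c * circleReflection c)
          * (circleReflection a ^ 2 * (c * circleReflection c)) ^ 2) := by ring
      _ = _ := by rw [h.e₄, e2]; push_cast; ring
  rw [Complex.ofReal_inj.1 e]
  simp only [Complex.normSq_eq_norm_sq]
  positivity

/-- The Cayley transform, mapping the unit circle without `-1` to the real line. -/
def cayley (r : ℂ) : ℂ := Complex.I * (1 - r) / (1 + r)

theorem cayley_circleReflection {r : ℂ} (h0 : r ≠ 0) (h1 : 1 + r ≠ 0) :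
    cayley (circleReflection r) = conj (cayley r) := by
  have h0' : conj r ≠ 0 := by simpa using h0
  have h1' : 1 + conj r ≠ 0 := by
    intro h
    apply h1
    have := congrArg conj h
    simpa using this
  have h1'' : conj r + 1 ≠ 0 := by rwa [add_comm]
  simp only [cayley, circleReflection, map_div₀, map_mul, map_sub, map_add, map_one, Complex.conj_I]
  field_simp
  ring

theorem ofReal_re_cayley {r : ℂ} (h : ‖r‖ = 1) (h1 : 1 + r ≠ 0) :
    (((cayley r).re : ℝ) : ℂ) = cayley r := by
  have h0 : r ≠ 0 := norm_ne_zero_iff.1 (by simp [h])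
  rw [← Complex.conj_eq_iff_re, ← cayley_circleReflection h0 h1, circleReflection_of_norm_eq_one h]

/-- This is the leading coefficient `A` of the Cayley transformed quartic. It vanishes exactly when
`-1`, where the transform is undefined, is among the roots. -/
theorem leadingCoeff_eq (h : QuarticData f₁ f₂ f₃ a b c d) :
    ((2 + 2 * f₁ + f₃ : ℝ) : ℂ) = (1 + a) * (1 + b) * (1 + c) * (1 + d) := by
  push_cast
  linear_combination -h.e₁ - h.e₂ - h.e₃ - h.e₄

/-- This and the next three lemmas are Vieta's formulas for `A y⁴ + 4 f₂ y³ + (2 f₃ - 12) y² + 4 f₂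
y + (2 + f₃ - 2 f₁)`. -/
theorem cayley_sum (h : QuarticData f₁ f₂ f₃ a b c d) (ha : 1 + a ≠ 0) (hb : 1 + b ≠ 0)
    (hc : 1 + c ≠ 0) (hd : 1 + d ≠ 0) :
    ((2 + 2 * f₁ + f₃ : ℝ) : ℂ) * (cayley a + cayley b + cayley c + cayley d) = -4 * f₂ := by
  rw [h.leadingCoeff_eq]
  unfold cayley
  field_simp
  linear_combination (2 * Complex.I) * h.e₁ - (2 * Complex.I) * h.e₃ - (4 * Complex.I) * h.e₄
    + 4 * f₂ * Complex.I_sq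

theorem cayley_sum_two (h : QuarticData f₁ f₂ f₃ a b c d) (ha : 1 + a ≠ 0) (hb : 1 + b ≠ 0)
    (hc : 1 + c ≠ 0) (hd : 1 + d ≠ 0) :
    ((2 + 2 * f₁ + f₃ : ℝ) : ℂ) * (cayley a * cayley b + cayley a * cayley c + cayley a * cayley d
      + cayley b * cayley c + cayley b * cayley d + cayley c * cayley d) = 2 * f₃ - 12 := by
  rw [h.leadingCoeff_eq]
  unfold cayley
  field_simp
  linear_combination (-2 * Complex.I ^ 2) * h.e₂ + (6 * Complex.I ^ 2) * h.e₄
    + (12 - 2 * f₃) * Complex.I_sq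

theorem cayley_sum_three (h : QuarticData f₁ f₂ f₃ a b c d) (ha : 1 + a ≠ 0) (hb : 1 + b ≠ 0)
    (hc : 1 + c ≠ 0) (hd : 1 + d ≠ 0) :
    ((2 + 2 * f₁ + f₃ : ℝ) : ℂ) * (cayley a * cayley b * cayley c + cayley a * cayley b * cayley d
      + cayley a * cayley c * cayley d + cayley b * cayley c * cayley d) = -4 * f₂ := by
  rw [h.leadingCoeff_eq]
  unfold cayley
  field_simp
  linear_combination (-2 * Complex.I ^ 3) * h.e₁ + (2 * Complex.I ^ 3) * h.e₃
    - (4 * Complex.I ^ 3) * h.e₄ - 4 * f₂ * (Complex.I ^ 2 - 1) * Complex.I_sq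

theorem cayley_prod (h : QuarticData f₁ f₂ f₃ a b c d) (ha : 1 + a ≠ 0) (hb : 1 + b ≠ 0)
    (hc : 1 + c ≠ 0) (hd : 1 + d ≠ 0) :
    ((2 + 2 * f₁ + f₃ : ℝ) : ℂ) * (cayley a * cayley b * cayley c * cayley d)
      = 2 + f₃ - 2 * f₁ := by
  rw [h.leadingCoeff_eq]
  unfold cayley
  field_simp
  linear_combination Complex.I ^ 4 * (-h.e₁ + h.e₂ - h.e₃ + h.e₄)
    + (2 + f₃ - 2 * f₁) * (Complex.I ^ 2 - 1) * Complex.I_sq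

/-- The quartic invariants in terms of the roots of the Cayley transformed polynomial. -/
theorem P4_eq (h : QuarticData f₁ f₂ f₃ a b c d) (ha : 1 + a ≠ 0) (hb : 1 + b ≠ 0)
    (hc : 1 + c ≠ 0) (hd : 1 + d ≠ 0) :
    (P4 f₁ f₂ f₃ : ℂ) = -((2 + 2 * f₁ + f₃ : ℝ) : ℂ) ^ 2
      * ((cayley a + cayley b - cayley c - cayley d) ^ 2
        + (cayley a - cayley b + cayley c - cayley d) ^ 2
        + (cayley a - cayley b - cayley c + cayley d) ^ 2) := by
  have h1 := h.cayley_sum ha hb hc hd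
  have h2 := h.cayley_sum_two ha hb hc hd
  have hf2 : (f₂ : ℂ) = -(((2 + 2 * f₁ + f₃ : ℝ) : ℂ)
    * (cayley a + cayley b + cayley c + cayley d)) / 4 := by rw [h1]; ring
  have e : (P4 f₁ f₂ f₃ : ℂ)
      = 8 * ((2 + 2 * f₁ + f₃ : ℝ) : ℂ) * (2 * f₃ - 12) - 48 * (f₂ : ℂ) ^ 2 := by
    unfold P4; push_cast; ring
  rw [e, ← h2, hf2]
  ring

/-- For a quartic with coefficients `A, B, C, D, E`, `P4` is the classical `8AC - 3B²` and `D4` is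
`64A³E - 16A²C² + 16AB²C - 16A²BD - 3B⁴`; Vieta's formulas turn the latter into the symmetric
function of the squared resolvents. -/
theorem D4_eq (h : QuarticData f₁ f₂ f₃ a b c d) (ha : 1 + a ≠ 0) (hb : 1 + b ≠ 0)
    (hc : 1 + c ≠ 0) (hd : 1 + d ≠ 0) :
    (D4 f₁ f₂ f₃ : ℂ) = -((2 + 2 * f₁ + f₃ : ℝ) : ℂ) ^ 4
      * ((cayley a + cayley b - cayley c - cayley d) ^ 2
          * (cayley a - cayley b + cayley c - cayley d) ^ 2
        + (cayley a + cayley b - cayley c - cayley d) ^ 2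
          * (cayley a - cayley b - cayley c + cayley d) ^ 2
        + (cayley a - cayley b + cayley c - cayley d) ^ 2
          * (cayley a - cayley b - cayley c + cayley d) ^ 2) := by
  have h1 := h.cayley_sum ha hb hc hd
  have h2 := h.cayley_sum_two ha hb hc hd
  have h3 := h.cayley_sum_three ha hb hc hd
  have h4 := h.cayley_prod ha hb hc hd
  have e : (D4 f₁ f₂ f₃ : ℂ)
      = 64 * ((2 + 2 * f₁ + f₃ : ℝ) : ℂ) ^ 3 * (2 + f₃ - 2 * f₁)
        - 16 * ((2 + 2 * f₁ + f₃ : ℝ) : ℂ) ^ 2 * (2 * f₃ - 12) ^ 2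
        + 16 * ((2 + 2 * f₁ + f₃ : ℝ) : ℂ) * (-4 * f₂) ^ 2 * (2 * f₃ - 12)
        - 16 * ((2 + 2 * f₁ + f₃ : ℝ) : ℂ) ^ 2 * (-4 * f₂) * (-4 * f₂) - 3 * (-4 * f₂) ^ 4 := by
    unfold D4; push_cast; ring
  generalize ((2 + 2 * f₁ + f₃ : ℝ) : ℂ) = A at *
  have e2 : 64 * A ^ 3 * (2 + f₃ - 2 * f₁) - 16 * A ^ 2 * (2 * f₃ - 12) ^ 2
        + 16 * A * (-4 * f₂) ^ 2 * (2 * f₃ - 12)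
        - 16 * A ^ 2 * (-4 * f₂) * (-4 * f₂) - 3 * (-4 * f₂ : ℂ) ^ 4
      = 64 * A ^ 3 * (A * (cayley a * cayley b * cayley c * cayley d))
        - 16 * A ^ 2 * (2 * f₃ - 12) ^ 2
        + 16 * A * (A * (cayley a + cayley b + cayley c + cayley d)) ^ 2 * (2 * f₃ - 12)
        - 16 * A ^ 2 * (A * (cayley a + cayley b + cayley c + cayley d))
          * (A * (cayley a * cayley b * cayley c + cayley a * cayley b * cayley d
      + cayley a * cayley c * cayley d + cayley b * cayley c * cayley d))
        - 3 * (A * (cayley a + cayley b + cayley c + cayley d)) ^ 4 := by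
    rw [h1, h3, h4]
  rw [e, e2, ← h2]
  ring

/-- The Cayley images are real, so the three resolvent squares are nonnegative. -/
theorem P4_nonpos_D4_nonpos_of_circle (h : QuarticData f₁ f₂ f₃ a b c d) (ha : ‖a‖ = 1)
    (hb : ‖b‖ = 1) (hc : ‖c‖ = 1) (hd : ‖d‖ = 1) (ha1 : 1 + a ≠ 0) (hb1 : 1 + b ≠ 0)
    (hc1 : 1 + c ≠ 0) (hd1 : 1 + d ≠ 0) : P4 f₁ f₂ f₃ ≤ 0 ∧ D4 f₁ f₂ f₃ ≤ 0 := by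
  have h1 := h.P4_eq ha1 hb1 hc1 hd1
  have h2 := h.D4_eq ha1 hb1 hc1 hd1
  rw [← ofReal_re_cayley ha ha1, ← ofReal_re_cayley hb hb1, ← ofReal_re_cayley hc hc1,
    ← ofReal_re_cayley hd hd1] at h1 h2
  constructor
  · rw [show P4 f₁ f₂ f₃ = _ from by exact_mod_cast h1, neg_mul, neg_nonpos]
    positivity
  · rw [show D4 f₁ f₂ f₃ = _ from by exact_mod_cast h2, neg_mul, neg_nonpos]
    positivity

/-- The Cayley images are two conjugate pairs, so one resolvent is real and the other two are purely
imaginary. -/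
theorem not_P4_neg_D4_neg_of_zero
    (h : QuarticData f₁ f₂ f₃ a (circleReflection a) c (circleReflection c)) (ha : a ≠ 0)
    (hc : c ≠ 0) (ha1 : 1 + a ≠ 0) (hc1 : 1 + c ≠ 0) (ha2 : 1 + circleReflection a ≠ 0)
    (hc2 : 1 + circleReflection c ≠ 0) : ¬ (P4 f₁ f₂ f₃ < 0 ∧ D4 f₁ f₂ f₃ < 0) := by
  have h1 := h.P4_eq ha1 ha2 hc1 hc2
  have h2 := h.D4_eq ha1 ha2 hc1 hc2
  rw [cayley_circleReflection ha ha1, cayley_circleReflection hc hc1] at h1 h2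
  set y := cayley a
  set w := cayley c
  have z1 : (y + conj y - w - conj w) ^ 2 = (((2 * (y.re - w.re)) ^ 2 : ℝ) : ℂ) := by
    rw [show y + conj y - w - conj w = (y + conj y) - (w + conj w) by ring, Complex.add_conj,
      Complex.add_conj]
    push_cast; ring
  have z2 : (y - conj y + w - conj w) ^ 2 = ((-(2 * (y.im + w.im)) ^ 2 : ℝ) : ℂ) := by
    rw [show y - conj y + w - conj w = (y - conj y) + (w - conj w) by ring, Complex.sub_conj,
      Complex.sub_conj]
    push_cast
    linear_combination (2 * (y.im + w.im : ℂ)) ^ 2 * Complex.I_sq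
  have z3 : (y - conj y - w + conj w) ^ 2 = ((-(2 * (y.im - w.im)) ^ 2 : ℝ) : ℂ) := by
    rw [show y - conj y - w + conj w = (y - conj y) - (w - conj w) by ring, Complex.sub_conj,
      Complex.sub_conj]
    push_cast
    linear_combination (2 * (y.im - w.im : ℂ)) ^ 2 * Complex.I_sq
  rw [z1, z2, z3] at h1 h2
  rintro ⟨hP, hD⟩
  have h1' : P4 f₁ f₂ f₃ = -(2 + 2 * f₁ + f₃) ^ 2 * ((2 * (y.re - w.re)) ^ 2
    + -(2 * (y.im + w.im)) ^ 2 + -(2 * (y.im - w.im)) ^ 2) := by exact_mod_cast h1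
  have h2' : D4 f₁ f₂ f₃ = -(2 + 2 * f₁ + f₃) ^ 4 * ((2 * (y.re - w.re)) ^ 2
    * -(2 * (y.im + w.im)) ^ 2 + (2 * (y.re - w.re)) ^ 2 * -(2 * (y.im - w.im)) ^ 2
      + -(2 * (y.im + w.im)) ^ 2 * -(2 * (y.im - w.im)) ^ 2) := by exact_mod_cast h2
  have p1 := sq_nonneg (2 * (y.re - w.re))
  have p2 := sq_nonneg (2 * (y.im + w.im))
  have p3 := sq_nonneg (2 * (y.im - w.im))
  generalize (2 * (y.re - w.re)) ^ 2 = x₁ at *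
  generalize (2 * (y.im + w.im)) ^ 2 = x₂ at *
  generalize (2 * (y.im - w.im)) ^ 2 = x₃ at *
  have k1 : 0 < x₁ + -x₂ + -x₃ := by
    by_contra hcon
    have := mul_nonneg (sq_nonneg (2 + 2 * f₁ + f₃)) (sub_nonneg.2 (not_lt.1 hcon))
    linarith
  have k2 : 0 < x₁ * -x₂ + x₁ * -x₃ + -x₂ * -x₃ := by
    by_contra hcon
    have := mul_nonneg (by positivity : 0 ≤ (2 + 2 * f₁ + f₃) ^ 4) (sub_nonneg.2 (not_lt.1 hcon))
    linarith
  -- `k1` says `x₁ > x₂ + x₃`, whence `x₁ (x₂ + x₃) ≥ (x₂ + x₃)² ≥ x₂ x₃`, against `k2`.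
  nlinarith [mul_nonneg p2 p3, mul_nonneg p2 k1.le, mul_nonneg p3 k1.le, sq_nonneg x₂,
    sq_nonneg x₃]

theorem one_add_ne_zero (h : QuarticData f₁ f₂ f₃ a b c d) (h0 : 2 + 2 * f₁ + f₃ ≠ 0) :
    1 + a ≠ 0 ∧ 1 + b ≠ 0 ∧ 1 + c ≠ 0 ∧ 1 + d ≠ 0 := by
  have h1 := h.leadingCoeff_eq
  have h2 : (1 + a) * (1 + b) * (1 + c) * (1 + d) ≠ 0 := by
    rw [← h1]
    exact_mod_cast h0
  simpa [mul_ne_zero_iff, and_assoc] using h2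

end QuarticData

/-- Replaces the Cayley argument when `-1` is a root; needed only when all roots lie on the circle,
since otherwise the transform is either defined or not used. -/
theorem P4_D4_of_leadingCoeff_eq_zero {f₁ f₂ f₃ : ℝ} (h0 : 2 + 2 * f₁ + f₃ = 0) :
    P4 f₁ f₂ f₃ ≤ 0 ∧ D4 f₁ f₂ f₃ ≤ 0 := by
  obtain rfl : f₃ = -2 - 2 * f₁ := by linarith
  constructor
  · have : P4 f₁ f₂ (-2 - 2 * f₁) = -48 * f₂ ^ 2 := by unfold P4; ring
    rw [this]
    nlinarith [sq_nonneg f₂]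
  · have : D4 f₁ f₂ (-2 - 2 * f₁) = -768 * (f₂ ^ 2) ^ 2 := by unfold D4; ring
    rw [this]
    nlinarith [sq_nonneg (f₂ ^ 2)]

/-- Symmetry equates the first two power sums of the inverse roots with the conjugates of those of
the roots. As the product is 1, inverting the roots exchanges `e₁` with `e₃` and fixes `e₂`. -/
theorem exists_quarticData {a b c d : ℂ}
    (hs : ({a, b, c, d} : Multiset ℂ).map circleReflection = {a, b, c, d})
    (h4 : a * b * c * d = 1) : ∃ f₁ f₂ f₃ : ℝ, QuarticData f₁ f₂ f₃ a b c d := by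
  have s1 := congrArg (fun s : Multiset ℂ => s.sum) hs
  have s2 := congrArg (fun s : Multiset ℂ => (s.map (· ^ 2)).sum) hs
  simp [circleReflection, ← add_assoc] at s1 s2
  have hne : ((a ≠ 0 ∧ b ≠ 0) ∧ c ≠ 0) ∧ d ≠ 0 := by
    simpa [mul_ne_zero_iff] using (h4 ▸ one_ne_zero : a * b * c * d ≠ 0)
  obtain ⟨⟨⟨ha, hb⟩, hc⟩, hd⟩ := hne
  have s1' := congrArg conj s1
  have s2' := congrArg conj s2
  simp at s1' s2'
  have e3 : a * b * c + a * b * d + a * c * d + b * c * d = conj (a + b + c + d) := by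
    simp only [map_add]
    rw [← s1']
    field_simp
    linear_combination (a * b * c + a * b * d + a * c * d + b * c * d) * h4
  have e2 : conj (a * b + a * c + a * d + b * c + b * d + c * d)
      = a * b + a * c + a * d + b * c + b * d + c * d := by
    have k1 : a * b + a * c + a * d + b * c + b * d + c * d
        = ((a + b + c + d) ^ 2 - (a ^ 2 + b ^ 2 + c ^ 2 + d ^ 2)) / 2 := by ring
    rw [k1]
    simp only [map_div₀, map_sub, map_pow, map_add, map_ofNat]
    rw [← s1', ← s2', ← k1]
    field_simp
    linear_combination (-2 * (a * b + a * c + a * d + b * c + b * d + c * d)) * a * b * c * d * h4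
  refine ⟨(a + b + c + d).re, (a + b + c + d).im,
    (a * b + a * c + a * d + b * c + b * d + c * d).re, ?_, ?_, ?_, h4⟩
  · rw [mul_comm, Complex.re_add_im]
  · rw [Complex.conj_eq_iff_re.1 e2]
  · rw [e3]
    apply Complex.ext
    · simp
    · simp
      ring

/-- The number of roots on the unit circle of a self-inversive quartic, in terms of the signs of
its invariants. -/
theorem card_circle_classification {s : Multiset ℂ} (hs : s.map circleReflection = s)
    (hcard : s.card = 4) (hprod : s.prod = 1) [DecidablePred fun r : ℂ => ‖r‖ = 1] :
    ((s.filter (fun r => ‖r‖ = 1)).card = 0 ∨ (s.filter (fun r => ‖r‖ = 1)).card = 2 ∨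
      (s.filter (fun r => ‖r‖ = 1)).card = 4) ∧
    ∃ f₁ f₂ f₃ : ℝ, s.sum = f₁ + Complex.I * f₂ ∧
      (1 / 2 : ℂ) * (s.sum ^ 2 - (s.map (· ^ 2)).sum) = f₃ ∧
      (Delta4 f₁ f₂ f₃ ≠ 0 → s.Nodup) ∧
      (Delta4 f₁ f₂ f₃ ≠ 0 → P4 f₁ f₂ f₃ ≠ 0 → D4 f₁ f₂ f₃ ≠ 0 →
        (0 < Delta4 f₁ f₂ f₃ ∧ P4 f₁ f₂ f₃ < 0 ∧ D4 f₁ f₂ f₃ < 0 →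
          (s.filter (fun r => ‖r‖ = 1)).card = 4) ∧
        (Delta4 f₁ f₂ f₃ < 0 → (s.filter (fun r => ‖r‖ = 1)).card = 2) ∧
        (0 < Delta4 f₁ f₂ f₃ ∧ (0 < P4 f₁ f₂ f₃ ∨ 0 < D4 f₁ f₂ f₃) →
          (s.filter (fun r => ‖r‖ = 1)).card = 0)) := by
  have h0 : (0 : ℂ) ∉ s := fun h => by
    rw [Multiset.prod_eq_zero h] at hprod
    exact zero_ne_one hprod
  obtain ⟨C, L, rfl, hC, hL⟩ := exists_eq_add_map_circleReflection hs h0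
  rw [card_filter_norm_eq_one hC hL]
  have hc : C.card + (L.card + L.card) = 4 := by simpa using hcard
  -- The coefficients and the simplicity of the roots do not depend on how many pairs are reflected;
  -- only the sign implications remain for the case distinction.
  have main : ∀ a b c d : ℂ, C + (L + L.map circleReflection) = {a, b, c, d} →
      (∀ f₁ f₂ f₃, QuarticData f₁ f₂ f₃ a b c d →
        (Delta4 f₁ f₂ f₃ ≠ 0 → P4 f₁ f₂ f₃ ≠ 0 → D4 f₁ f₂ f₃ ≠ 0 →
        (0 < Delta4 f₁ f₂ f₃ ∧ P4 f₁ f₂ f₃ < 0 ∧ D4 f₁ f₂ f₃ < 0 → C.card = 4) ∧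
        (Delta4 f₁ f₂ f₃ < 0 → C.card = 2) ∧
        (0 < Delta4 f₁ f₂ f₃ ∧ (0 < P4 f₁ f₂ f₃ ∨ 0 < D4 f₁ f₂ f₃) → C.card = 0))) →
      ∃ f₁ f₂ f₃ : ℝ, (C + (L + L.map circleReflection)).sum = f₁ + Complex.I * f₂ ∧
      (1 / 2 : ℂ) * ((C + (L + L.map circleReflection)).sum ^ 2
        - ((C + (L + L.map circleReflection)).map (· ^ 2)).sum) = f₃ ∧
      (Delta4 f₁ f₂ f₃ ≠ 0 → (C + (L + L.map circleReflection)).Nodup) ∧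
      (Delta4 f₁ f₂ f₃ ≠ 0 → P4 f₁ f₂ f₃ ≠ 0 → D4 f₁ f₂ f₃ ≠ 0 →
        (0 < Delta4 f₁ f₂ f₃ ∧ P4 f₁ f₂ f₃ < 0 ∧ D4 f₁ f₂ f₃ < 0 → C.card = 4) ∧
        (Delta4 f₁ f₂ f₃ < 0 → C.card = 2) ∧
        (0 < Delta4 f₁ f₂ f₃ ∧ (0 < P4 f₁ f₂ f₃ ∨ 0 < D4 f₁ f₂ f₃) → C.card = 0)) := by
    intro a b c d habcd H
    rw [habcd] at hs hprod ⊢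
    have h4 : a * b * c * d = 1 := by simpa [mul_assoc] using hprod
    obtain ⟨f₁, f₂, f₃, hf⟩ := exists_quarticData hs h4
    refine ⟨f₁, f₂, f₃, ?_, ?_, ?_, H f₁ f₂ f₃ hf⟩
    · rw [← hf.e₁]; simp [add_assoc]
    · rw [← hf.e₂]; simp; ring
    · intro hD
      have hD' : ((a - b) * (a - c) * (a - d) * (b - c) * (b - d) * (c - d)) ^ 2 ≠ 0 := by
        rw [← hf.Delta4_eq]; exact_mod_cast hD
      simp only [ne_eq, pow_eq_zero_iff, OfNat.ofNat_ne_zero, not_false_eq_true, mul_eq_zero,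
        sub_eq_zero, not_or] at hD'
      simp [hD']
  -- `L` holds the inner point of each reflected pair; 0, 1 or 2 pairs leave 4, 2 or 0 points on the
  -- circle.
  have hLc : L.card = 0 ∨ L.card = 1 ∨ L.card = 2 := by omega
  rcases hLc with hl | hl | hl
  · have hC4 : C.card = 4 := by omega
    refine ⟨Or.inr (Or.inr hC4), ?_⟩
    obtain rfl := Multiset.card_eq_zero.1 hl
    obtain ⟨a, b, c, d, rfl⟩ : ∃ a b c d, C = {a, b, c, d} := by
      obtain ⟨a, C, rfl⟩ := Multiset.card_pos_iff_exists_mem.1 (by omega : 0 < C.card) |>.imp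
        fun a ha => Multiset.exists_cons_of_mem ha
      obtain ⟨b, c, d, rfl⟩ := Multiset.card_eq_three.1 (by simpa using hC4)
      exact ⟨a, b, c, d, rfl⟩
    have ha := hC a (by simp)
    have hb := hC b (by simp)
    have hc := hC c (by simp)
    have hd := hC d (by simp)
    refine main a b c d (by simp) fun f₁ f₂ f₃ hf hD hP hR => ⟨fun _ => hC4, fun h => ?_, ?_⟩
    · exact absurd (hf.Delta4_nonneg_of_circle ha hb hc hd) (not_le.2 h)
    · rintro ⟨-, h⟩
      exfalso
      have : P4 f₁ f₂ f₃ ≤ 0 ∧ D4 f₁ f₂ f₃ ≤ 0 := by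
        by_cases h0 : 2 + 2 * f₁ + f₃ = 0
        · exact P4_D4_of_leadingCoeff_eq_zero h0
        · obtain ⟨h1, h2, h3, h4⟩ := hf.one_add_ne_zero h0
          exact hf.P4_nonpos_D4_nonpos_of_circle ha hb hc hd h1 h2 h3 h4
      rcases h with h | h <;> linarith [this.1, this.2]
  · have hC2 : C.card = 2 := by omega
    refine ⟨Or.inr (Or.inl hC2), ?_⟩
    obtain ⟨c, rfl⟩ := Multiset.card_eq_one.1 hl
    obtain ⟨a, b, rfl⟩ := Multiset.card_eq_two.1 hC2
    refine main a b c (circleReflection c)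
      (by simp only [Multiset.map_singleton]; rfl) fun f₁ f₂ f₃ hf hD hP hR =>
      ⟨fun h => ?_, fun _ => hC2, fun h => ?_⟩
    all_goals
      exact absurd (hf.Delta4_nonpos_of_two (hC a (by simp)) (hC b (by simp)) (hL c (by simp)).1)
        (not_le.2 h.1)
  · have hC0 : C.card = 0 := by omega
    refine ⟨Or.inl hC0, ?_⟩
    obtain rfl := Multiset.card_eq_zero.1 hC0
    obtain ⟨a, c, rfl⟩ := Multiset.card_eq_two.1 hl
    have ha := hL a (by simp)
    have hc := hL c (by simp)
    have off : ∀ r : ℂ, r ≠ 0 → ‖r‖ < 1 → 1 + r ≠ 0 ∧ 1 + circleReflection r ≠ 0 := by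
      intro r hr hr1
      constructor
      · intro h
        rw [show r = -1 by linear_combination h] at hr1
        simp at hr1
      · intro h
        have h' := norm_circleReflection r
        rw [show circleReflection r = -1 by linear_combination h] at h'
        simp only [norm_neg, norm_one] at h'
        rw [eq_comm, inv_eq_one] at h'
        linarith
    refine main a (circleReflection a) c (circleReflection c) ?_ fun f₁ f₂ f₃ hf hD hP hR =>
      ⟨fun h => ?_, fun h => ?_, fun _ => hC0⟩
    · simp only [zero_add, Multiset.insert_eq_cons, Multiset.map_cons, Multiset.map_singleton,
        Multiset.cons_add, Multiset.singleton_add]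
      rw [Multiset.cons_swap c]
    · exact absurd h.2 (hf.not_P4_neg_D4_neg_of_zero ha.1 hc.1 (off a ha.1 ha.2).1
        (off c hc.1 hc.2).1 (off a ha.1 ha.2).2 (off c hc.1 hc.2).2)
    · exact absurd (hf.Delta4_nonneg_of_zero ha.1 hc.1) (not_le.2 h)

end Floquet

-- Fundamental matrices, Liouville's formula and Schwarz reflection.

namespace Floquet

open scoped ComplexConjugate Topology
open Filter

/-- Entrywise derivative of a matrix-valued function. -/
def HasEntryDeriv {l m : Type*} (X : ℝ → Matrix l m ℂ) (X' : Matrix l m ℂ) (x : ℝ) : Prop :=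
  ∀ i j, HasDerivAt (fun y => X y i j) (X' i j) x

namespace HasEntryDeriv

variable {l m n : Type*}

theorem const (X : Matrix l m ℂ) (x : ℝ) : HasEntryDeriv (fun _ => X) 0 x :=
  fun i j => hasDerivAt_const x (X i j)

theorem mul [Fintype m] {X : ℝ → Matrix l m ℂ} {Y : ℝ → Matrix m n ℂ} {X' : Matrix l m ℂ}
    {Y' : Matrix m n ℂ} {x : ℝ} (hX : HasEntryDeriv X X' x) (hY : HasEntryDeriv Y Y' x) :
    HasEntryDeriv (fun y => X y * Y y) (X' * Y x + X x * Y') x := by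
  intro i j
  simp only [Matrix.mul_apply, Matrix.add_apply, ← Finset.sum_add_distrib]
  exact HasDerivAt.fun_sum fun k _ => (hX i k).mul (hY k j)

theorem transpose {X : ℝ → Matrix l m ℂ} {X' : Matrix l m ℂ} {x : ℝ} (hX : HasEntryDeriv X X' x) :
    HasEntryDeriv (fun y => (X y)ᵀ) X'ᵀ x := fun i j => hX j i

theorem eq_of_zero {X : ℝ → Matrix l m ℂ} (hX : ∀ x, HasEntryDeriv X 0 x) (x y : ℝ) :
    X x = X y := by
  ext i j
  exact is_const_of_deriv_eq_zero (fun z => (hX z i j).differentiableAt)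
    (fun z => (hX z i j).deriv) x y

theorem congr {X : ℝ → Matrix l m ℂ} {X' X'' : Matrix l m ℂ} {x : ℝ} (hX : HasEntryDeriv X X' x)
    (h : X' = X'') : HasEntryDeriv X X'' x := h ▸ hX

theorem comp_add_const {X : ℝ → Matrix l m ℂ} {X' : Matrix l m ℂ} {x T : ℝ}
    (hX : HasEntryDeriv X X' (x + T)) : HasEntryDeriv (fun y => X (y + T)) X' x :=
  fun i j => (hX i j).comp_add_const x T

theorem map_conj {X : ℝ → Matrix l m ℂ} {X' : Matrix l m ℂ} {x : ℝ} (hX : HasEntryDeriv X X' x) :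
    HasEntryDeriv (fun y => (X y).map conj) (X'.map conj) x :=
  fun i j => (hX i j).star

/-- The derivative of the determinant along a solution of `X' = A X`. -/
theorem det [Fintype n] [DecidableEq n] {X : ℝ → Matrix n n ℂ} {A : Matrix n n ℂ} {x : ℝ}
    (hX : HasEntryDeriv X (A * X x) x) :
    HasDerivAt (fun y => (X y).det) (A.trace * (X x).det) x := by
  -- Row `i` of `A X` is a combination of the rows of `X`; once it replaces row `i`, only the
  -- diagonal term `A i i` survives in the determinant.
  have e : A.trace * (X x).det = ∑ i, ((X x).updateRow i ((A * X x) i)).det := by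
    rw [Matrix.trace, Finset.sum_mul]
    refine Finset.sum_congr rfl fun i _ => ?_
    have : (A * X x) i = ∑ k, A i k • X x k := by
      ext j; simp [Matrix.mul_apply]
    rw [this, Matrix.det_updateRow_sum, Matrix.diag_apply, smul_eq_mul]
  rw [e]
  have e2 : ∀ i, ((X x).updateRow i ((A * X x) i)).det = ∑ σ : Equiv.Perm n,
      (Equiv.Perm.sign σ : ℂ) * ((∏ j ∈ Finset.univ.erase i, X x j (σ j)) * (A * X x) i (σ i)) := by
    intro i
    rw [← Matrix.det_transpose, Matrix.det_apply']
    refine Finset.sum_congr rfl fun σ _ => ?_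
    rw [← Finset.prod_erase_mul _ _ (Finset.mem_univ i)]
    congr 2
    · refine Finset.prod_congr rfl fun j hj => ?_
      rw [Matrix.transpose_apply, Matrix.updateRow_ne (Finset.ne_of_mem_erase hj)]
    · simp
  simp_rw [e2]
  rw [Finset.sum_comm]
  have e3 : (fun y => (X y).det) = fun y => ∑ σ : Equiv.Perm n,
      (Equiv.Perm.sign σ : ℂ) * ∏ j, X y j (σ j) := by
    funext y
    rw [← Matrix.det_transpose, Matrix.det_apply']
    rfl
  rw [e3]
  refine HasDerivAt.fun_sum fun σ _ => ?_
  rw [← Finset.mul_sum]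
  refine HasDerivAt.const_mul _ ?_
  simpa using HasDerivAt.fun_finsetProd (u := Finset.univ) fun j _ => hX j (σ j)

end HasEntryDeriv

section Fundamental

variable {n : ℕ} {A V : ℝ → Matrix (Fin n) (Fin n) ℂ}

theorem IsFundamentalMatrix.hasEntryDeriv (hV : IsFundamentalMatrix A V) (x : ℝ) :
    HasEntryDeriv V (A x * V x) x := hV.2 x

/-- Liouville's formula for a trace-free coefficient matrix. -/
theorem IsFundamentalMatrix.det_eq_one (hV : IsFundamentalMatrix A V) (htr : ∀ x, (A x).trace = 0)
    (x : ℝ) : (V x).det = 1 := by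
  have h : ∀ y, HasDerivAt (fun y => (V y).det) 0 y := fun y => by
    simpa [htr] using (hV.hasEntryDeriv y).det
  have := is_const_of_deriv_eq_zero (fun z => (h z).differentiableAt) (fun z => (h z).deriv) x 0
  rw [this, hV.1, Matrix.det_one]

theorem IsFundamentalMatrix.inv_mul (hV : IsFundamentalMatrix A V) (htr : ∀ x, (A x).trace = 0)
    (x : ℝ) : (V x)⁻¹ * V x = 1 :=
  Matrix.nonsing_inv_mul _ (by rw [hV.det_eq_one htr]; exact isUnit_one)

theorem IsFundamentalMatrix.mul_inv (hV : IsFundamentalMatrix A V) (htr : ∀ x, (A x).trace = 0)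
    (x : ℝ) : V x * (V x)⁻¹ = 1 :=
  Matrix.mul_nonsing_inv _ (by rw [hV.det_eq_one htr]; exact isUnit_one)

/-- Since the determinant is 1, the inverse is the adjugate, polynomial in the entries and hence
differentiable. Differentiating `V⁻¹ V = 1` then identifies the derivative. -/
theorem IsFundamentalMatrix.hasEntryDeriv_inv (hV : IsFundamentalMatrix A V)
    (htr : ∀ x, (A x).trace = 0) (x : ℝ) :
    HasEntryDeriv (fun y => (V y)⁻¹) (-((V x)⁻¹ * A x)) x := by
  have hd : ∀ i j, DifferentiableAt ℝ (fun y => (V y)⁻¹ i j) x := by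
    intro i j
    have e : (fun y => (V y)⁻¹ i j) = fun y => (V y).adjugate i j := by
      funext y
      rw [Matrix.inv_def, hV.det_eq_one htr]
      simp
    rw [e]
    simp only [Matrix.adjugate_apply, Matrix.det_apply']
    refine DifferentiableAt.fun_sum fun σ _ => DifferentiableAt.const_mul ?_ _
    refine DifferentiableAt.fun_finsetProd fun k _ => ?_
    by_cases h : σ k = j
    · simp [h]
    · simp only [Matrix.updateRow_ne h]
      exact (hV.2 x (σ k) k).differentiableAt
  obtain ⟨X', hW⟩ : ∃ X' : Matrix (Fin n) (Fin n) ℂ, HasEntryDeriv (fun y => (V y)⁻¹) X' x :=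
    ⟨Matrix.of fun i j => deriv (fun y => (V y)⁻¹ i j) x, fun i j => (hd i j).hasDerivAt⟩
  refine hW.congr ?_
  have h1 := hW.mul (hV.hasEntryDeriv x)
  have h2 : HasEntryDeriv (fun y => (V y)⁻¹ * V y) 0 x := by
    simp only [hV.inv_mul htr]
    exact HasEntryDeriv.const _ x
  have h3 : X' * V x + (V x)⁻¹ * (A x * V x) = 0 := by
    ext i j
    exact (h1 i j).unique (h2 i j)
  have h4 := congrArg (· * (V x)⁻¹) h3
  simp only [Matrix.add_mul, Matrix.mul_assoc, hV.mul_inv htr, Matrix.mul_one,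
    Matrix.zero_mul] at h4
  exact eq_neg_of_add_eq_zero_left h4

/-- Solutions of `X' = A X` are determined by their initial values. -/
theorem IsFundamentalMatrix.eq_mul {m : Type*} (hV : IsFundamentalMatrix A V)
    (htr : ∀ x, (A x).trace = 0) {X : ℝ → Matrix (Fin n) m ℂ}
    (hX : ∀ x, HasEntryDeriv X (A x * X x) x) (x : ℝ) : X x = V x * X 0 := by
  have h : ∀ y, HasEntryDeriv (fun y => (V y)⁻¹ * X y) 0 y := fun y =>
    ((hV.hasEntryDeriv_inv htr y).mul (hX y)).congr (by
      rw [Matrix.neg_mul, Matrix.mul_assoc, neg_add_cancel])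
  have h1 := HasEntryDeriv.eq_of_zero h x 0
  simp only [hV.1, inv_one, Matrix.one_mul] at h1
  rw [← h1, ← Matrix.mul_assoc, hV.mul_inv htr, Matrix.one_mul]

theorem IsFundamentalMatrix.add_period (hV : IsFundamentalMatrix A V)
    (htr : ∀ x, (A x).trace = 0) {T : ℝ} (hper : ∀ x, A (x + T) = A x) (x : ℝ) :
    V (x + T) = V x * V T := by
  have := hV.eq_mul htr (X := fun x => V (x + T)) (fun x => by
    have := (hV.hasEntryDeriv (x + T)).comp_add_const
    rwa [hper] at this) x
  simpa using this

end Fundamental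

/-- Reflection of the coefficient matrix in the real axis of the spectral parameter. -/
theorem conj_eq_of_real {S : Set ℂ} (hS : S.Finite) {f : ℂ → ℂ} (hf : DifferentiableOn ℂ f Sᶜ)
    (hreal : ∀ r : ℝ, (r : ℂ) ∉ S → (f r).im = 0) {z : ℂ} (hz : z ∉ S) (hz' : conj z ∉ S) :
    f (conj z) = conj (f z) := by
  -- Removing `S` and its mirror image leaves a connected domain invariant under conjugation. There
  -- `f` and `conj ∘ f ∘ conj` agree on the real points, so the identity theorem applies.
  set S' : Set ℂ := S ∪ (conj ⁻¹' S) with hS'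
  have hfin : S'.Finite := hS.union (hS.preimage (star_injective.injOn))
  have hopen : IsOpen S'ᶜ := hfin.isClosed.isOpen_compl
  have hconn : IsPreconnected S'ᶜ :=
    (hfin.countable.isConnected_compl_of_one_lt_rank (by simp)).isPreconnected
  have hSo : IsOpen Sᶜ := hS.isClosed.isOpen_compl
  have h1 : AnalyticOnNhd ℂ f S'ᶜ :=
    (hf.mono (Set.compl_subset_compl.2 Set.subset_union_left)).analyticOnNhd hopen
  have h2 : AnalyticOnNhd ℂ (conj ∘ f ∘ conj) S'ᶜ := by
    refine DifferentiableOn.analyticOnNhd (fun w hw => ?_) hopen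
    have hw' : conj w ∈ Sᶜ := fun h => hw (Or.inr h)
    have := ((hf _ hw').differentiableAt (hSo.mem_nhds hw')).conj_conj
    rw [Complex.conj_conj] at this
    exact this.differentiableWithinAt
  have hRfin : ((fun r : ℝ => (r : ℂ)) ⁻¹' S').Finite :=
    hfin.preimage Complex.ofReal_injective.injOn
  obtain ⟨r₀, hr₀⟩ : ∃ r₀ : ℝ, r₀ ∉ ((fun r : ℝ => (r : ℂ)) ⁻¹' S') :=
    hRfin.infinite_compl.nonempty
  have hfreq : ∃ᶠ w in 𝓝[≠] (r₀ : ℂ), f w = (conj ∘ f ∘ conj) w := by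
    have hev : ∀ᶠ r : ℝ in 𝓝[≠] r₀, f (r : ℂ) = (conj ∘ f ∘ conj) (r : ℂ) := by
      have : ∀ᶠ r : ℝ in 𝓝 r₀, r ∉ ((fun r : ℝ => (r : ℂ)) ⁻¹' S') :=
        hRfin.isClosed.isOpen_compl.mem_nhds hr₀
      filter_upwards [nhdsWithin_le_nhds this] with r hr
      have hr' : (r : ℂ) ∉ S := fun h => hr (Or.inl h)
      simp only [Function.comp, Complex.conj_ofReal]
      exact (Complex.conj_eq_iff_im.2 (hreal r hr')).symm
    have htend : Tendsto (fun r : ℝ => (r : ℂ)) (𝓝[≠] r₀) (𝓝[≠] (r₀ : ℂ)) := by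
      refine tendsto_nhdsWithin_of_tendsto_nhds_of_eventually_within _
        (Complex.continuous_ofReal.continuousAt.mono_left nhdsWithin_le_nhds) ?_
      filter_upwards [self_mem_nhdsWithin] with r hr
      simpa using hr
    exact htend.frequently hev.frequently
  have key := h1.eqOn_of_preconnected_of_frequently_eq h2 hconn hr₀ hfreq
  have := key (show conj z ∈ S'ᶜ from by
    rintro (h | h)
    · exact hz' h
    · exact hz (by simpa using h))
  simpa using this

-- Continuous dependence on the spectral parameter.

section Parameter

variable {n : ℕ}

theorem norm_mulVec_le {A : Matrix (Fin n) (Fin n) ℂ} {K : ℝ} (hA : ∀ i j, ‖A i j‖ ≤ K)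
    (v : Fin n → ℂ) : ‖A *ᵥ v‖ ≤ n * K * ‖v‖ := by
  have hK : ∀ _ : Fin n, 0 ≤ K := fun i => (norm_nonneg _).trans (hA i i)
  have hK' : 0 ≤ n * K * ‖v‖ := by
    rcases Nat.eq_zero_or_pos n with rfl | hn
    · simp
    · have := hK ⟨0, hn⟩
      positivity
  refine (pi_norm_le_iff_of_nonneg hK').2 fun i => ?_
  calc ‖(A *ᵥ v) i‖ = ‖∑ j, A i j * v j‖ := rfl
    _ ≤ ∑ j, ‖A i j * v j‖ := norm_sum_le _ _
    _ ≤ ∑ _j : Fin n, K * ‖v‖ := Finset.sum_le_sum fun j _ => by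
        rw [norm_mul]
        exact mul_le_mul (hA i j) (norm_le_pi_norm v j) (norm_nonneg _) (hK i)
    _ = n * K * ‖v‖ := by simp; ring

/-- The fundamental matrix depends continuously on the parameter. -/
theorem continuousAt_fundamentalMatrix {A : ℝ → ℂ → Matrix (Fin n) (Fin n) ℂ} {U : Set ℂ}
    (hU : IsOpen U) (hcont : ContinuousOn (fun p : ℝ × ℂ => A p.1 p.2) (Set.univ ×ˢ U))
    {V : ℝ → ℂ → Matrix (Fin n) (Fin n) ℂ}
    (hV : ∀ lam ∈ U, IsFundamentalMatrix (fun x => A x lam) (fun x => V x lam)) {T : ℝ}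
    (hT : 0 ≤ T) {lam : ℂ} (hlam : lam ∈ U) : ContinuousAt (fun l => V T l) lam := by
  refine tendsto_pi_nhds.2 fun i => tendsto_pi_nhds.2 fun j => ?_
  have hVd : ∀ l ∈ U, ∀ x, HasDerivAt (fun y => (V y l)ᵀ j) (A x l *ᵥ (V x l)ᵀ j) x := by
    intro l hl x
    rw [hasDerivAt_pi]
    intro k
    exact (hV l hl).2 x k j
  have hentry : ∀ k m, ContinuousOn (fun p : ℝ × ℂ => A p.1 p.2 k m) (Set.univ ×ˢ U) := fun k m =>
    (continuous_apply m).comp_continuousOn ((continuous_apply k).comp_continuousOn hcont)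
  -- bounds on the compact interval
  have hA0 : ∀ k m, ContinuousOn (fun x => A x lam k m) (Set.Icc 0 T) := fun k m =>
    (hentry k m).comp (by fun_prop : ContinuousOn (fun x : ℝ => (x, lam)) (Set.Icc 0 T))
      (fun x _ => ⟨trivial, hlam⟩)
  have hbd : ∃ K : ℝ, 0 ≤ K ∧ ∀ x ∈ Set.Icc 0 T, ∀ k m, ‖A x lam k m‖ ≤ K := by
    choose K hK using fun k m => isCompact_Icc.exists_bound_of_continuousOn (hA0 k m)
    refine ⟨∑ k, ∑ m, |K k m|, by positivity, fun x hx k m => ?_⟩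
    calc _ ≤ K k m := hK k m x hx
      _ ≤ |K k m| := le_abs_self _
      _ ≤ ∑ m, |K k m| := Finset.single_le_sum (f := fun m => |K k m|)
          (fun _ _ => abs_nonneg _) (Finset.mem_univ m)
      _ ≤ _ := Finset.single_le_sum (f := fun k => ∑ m, |K k m|)
          (fun _ _ => Finset.sum_nonneg fun _ _ => abs_nonneg _) (Finset.mem_univ k)
  obtain ⟨K, hK0, hK⟩ := hbd
  obtain ⟨C, hC⟩ := isCompact_Icc.exists_bound_of_continuousOn (s := Set.Icc 0 T)
    (f := fun x => (V x lam)ᵀ j) (fun x _ => (hVd lam hlam x).continuousAt.continuousWithinAt)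
  have hC0 : 0 ≤ C := (norm_nonneg _).trans (hC 0 ⟨le_rfl, hT⟩)
  rw [Metric.tendsto_nhds]
  intro δ hδ
  -- smallness of the Gronwall bound
  have hg : Tendsto (fun ε => gronwallBound 0 (n * (K + 1)) (n * ε * C) T) (𝓝[>] 0) (𝓝 0) := by
    have h1 := (gronwallBound_continuous_ε 0 (n * (K + 1)) T).comp
      (by fun_prop : Continuous fun ε : ℝ => n * ε * C)
    have h2 := h1.tendsto 0
    simp only [Function.comp, mul_zero, zero_mul, gronwallBound_ε0_δ0] at h2
    exact h2.mono_left nhdsWithin_le_nhds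
  obtain ⟨ε, ⟨hε1, hε⟩, hε0⟩ := (((hg.eventually (gt_mem_nhds hδ)).and
    (nhdsWithin_le_nhds (gt_mem_nhds (zero_lt_one)))).and self_mem_nhdsWithin).exists
  have hε0 : 0 < ε := hε0
  -- Compactness of `[0, T]` makes the closeness uniform in `x`.
  have hnear : ∀ᶠ l in 𝓝 lam, ∀ k m, ∀ x ∈ Set.Icc 0 T, ‖A x l k m - A x lam k m‖ ≤ ε := by
    refine eventually_all.2 fun k => eventually_all.2 fun m => ?_
    obtain ⟨v, hv, hv'⟩ := isCompact_Icc.mem_uniformity_of_prod (s := U) (k := Set.Icc 0 T)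
      (f := fun l x => A x l k m) (q := lam)
      ((hentry k m).comp (continuous_swap.continuousOn) (fun p hp => ⟨trivial, hp.1⟩)) hlam
      (Metric.dist_mem_uniformity hε0)
    rw [hU.nhdsWithin_eq hlam] at hv
    filter_upwards [hv] with l hl x hx
    have := hv' l hl x hx
    rw [← dist_eq_norm]
    exact le_of_lt this
  filter_upwards [hnear, hU.mem_nhds hlam] with l hl hlU
  -- The difference `w` of the `j`-th columns starts at 0 and satisfies `‖w'‖ ≤ n (K + 1) ‖w‖ + n ε
  -- C`: `K + 1` bounds the coefficients at `l` because `ε < 1`, and `C` bounds the column at `lam`.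
  have key := norm_le_gronwallBound_of_norm_deriv_right_le (a := 0) (b := T)
    (f := fun x => (V x l)ᵀ j - (V x lam)ᵀ j)
    (f' := fun x => A x l *ᵥ (V x l)ᵀ j - A x lam *ᵥ (V x lam)ᵀ j) (δ := 0)
    (K := n * (K + 1)) (ε := n * ε * C)
    (fun x _ => ((hVd l hlU x).sub (hVd lam hlam x)).continuousAt.continuousWithinAt)
    (fun x _ => ((hVd l hlU x).sub (hVd lam hlam x)).hasDerivWithinAt)
    (by
      have e : V 0 l = V 0 lam := (hV l hlU).1.trans (hV lam hlam).1.symm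
      simp [e]) (fun x hx => by
      have hx' := Set.Ico_subset_Icc_self hx
      have e : A x l *ᵥ (V x l)ᵀ j - A x lam *ᵥ (V x lam)ᵀ j
          = A x l *ᵥ ((V x l)ᵀ j - (V x lam)ᵀ j) + (A x l - A x lam) *ᵥ (V x lam)ᵀ j := by
        rw [Matrix.mulVec_sub, Matrix.sub_mulVec]; abel
      rw [e]
      refine (norm_add_le _ _).trans (add_le_add (norm_mulVec_le (fun k m => ?_) _) ?_)
      · calc ‖A x l k m‖ = ‖A x lam k m + (A x l k m - A x lam k m)‖ := by congr 1; ring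
          _ ≤ ‖A x lam k m‖ + ‖A x l k m - A x lam k m‖ := norm_add_le _ _
          _ ≤ K + 1 := add_le_add (hK x hx' k m) ((hl k m x hx').trans hε.le)
      · refine (norm_mulVec_le (fun k m => hl k m x hx') _).trans ?_
        exact mul_le_mul_of_nonneg_left (hC x hx') (by positivity)) T ⟨hT, le_rfl⟩
  rw [dist_eq_norm]
  calc ‖V T l i j - V T lam i j‖ ≤ ‖(V T l)ᵀ j - (V T lam)ᵀ j‖ :=
        norm_le_pi_norm ((V T l)ᵀ j - (V T lam)ᵀ j) i
    _ < δ := by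
      refine lt_of_le_of_lt key ?_
      rw [sub_zero]
      exact hε1

end Parameter

-- Symmetry of the multipliers about the unit circle.

section Symmetry

variable {n : ℕ}

/-- The determinantal form of the symmetry of the monodromy matrix of a reversible problem. -/
theorem det_scalar_sub_monodromy {A A' V V' : ℝ → Matrix (Fin n) (Fin n) ℂ}
    (hV : IsFundamentalMatrix A V) (hV' : IsFundamentalMatrix A' V') (htr : ∀ x, (A x).trace = 0)
    {B : Matrix (Fin n) (Fin n) ℂ} (hB : B.det ≠ 0) (hAB : ∀ x, (A x)ᵀ * B = -(B * A' x))
    (x : ℝ) (t : ℂ) :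
    (Matrix.scalar (Fin n) t - V' x).det = (t • V x - 1).det := by
  -- The derivative of `Vᵀ B V'` is `Vᵀ (Aᵀ B + B A') V' = 0`.
  have h : ∀ y, HasEntryDeriv (fun y => (V y)ᵀ * B * V' y) 0 y := fun y => by
    refine (((hV.hasEntryDeriv y).transpose.mul (HasEntryDeriv.const B y)).mul
      (hV'.hasEntryDeriv y)).congr ?_
    rw [Matrix.mul_zero, add_zero, Matrix.transpose_mul, Matrix.mul_assoc (V y)ᵀ, hAB]
    simp only [Matrix.mul_neg, Matrix.neg_mul, Matrix.mul_assoc]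
    exact neg_add_cancel _
  have h1 : (V x)ᵀ * B * V' x = B := by
    have := HasEntryDeriv.eq_of_zero h x 0
    simpa [hV.1, hV'.1] using this
  have h2 : (V x)ᵀ * B * (Matrix.scalar (Fin n) t - V' x) = (t • V x - 1)ᵀ * B := by
    rw [Matrix.mul_sub, h1, Matrix.transpose_sub, Matrix.sub_mul, Matrix.transpose_smul,
      Matrix.transpose_one, Matrix.one_mul, Matrix.scalar_apply, ← Matrix.smul_one_eq_diagonal,
      Matrix.mul_smul, Matrix.mul_one, Matrix.smul_mul]
  have h3 := congrArg Matrix.det h2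
  rw [Matrix.det_mul, Matrix.det_mul, Matrix.det_mul, Matrix.det_transpose, Matrix.det_transpose,
    hV.det_eq_one htr, one_mul, mul_comm] at h3
  exact mul_right_cancel₀ hB h3

/-- A determinantal identity characterizing spectra symmetric about the unit circle. -/
theorem map_circleReflection_roots_charpoly {M : Matrix (Fin n) (Fin n) ℂ}
    (hdet : M.det = 1)
    (h : ∀ t : ℂ, (Matrix.scalar (Fin n) t - M.map conj).det = (t • M - 1).det) :
    M.charpoly.roots.map circleReflection = M.charpoly.roots := by
  set s := M.charpoly.roots with hs
  have hcard : s.card = n := by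
    rw [hs, Polynomial.splits_iff_card_roots.1 (IsAlgClosed.splits M.charpoly),
      M.charpoly_natDegree_eq_dim, Fintype.card_fin]
  have hp : ∀ t, (Matrix.scalar (Fin n) t - M).det = (s.map (fun r => t - r)).prod := by
    intro t
    rw [← Matrix.eval_charpoly, (IsAlgClosed.splits M.charpoly).eval_eq_prod_roots_of_monic
      M.charpoly_monic]
  have hprod : s.prod = 1 := by rw [← hdet, Matrix.det_eq_prod_roots_charpoly]
  have h0 : (0 : ℂ) ∉ s := fun h => by
    rw [Multiset.prod_eq_zero h] at hprod
    exact zero_ne_one hprod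
  have hconj : ∀ t, (Matrix.scalar (Fin n) t - M.map conj).det
      = (s.map (fun r => t - conj r)).prod := by
    intro t
    have e : Matrix.scalar (Fin n) t - M.map conj
        = (Matrix.scalar (Fin n) (conj t) - M).map (starRingEnd ℂ) := by
      ext i j
      by_cases hij : i = j <;> simp [hij, Matrix.scalar_apply]
    rw [e, ← RingHom.mapMatrix_apply, ← RingHom.map_det, hp, map_multiset_prod, Multiset.map_map]
    simp
  have hrev : ∀ t, t ≠ 0 → (t • M - 1).det = (s.map (fun r => t - r⁻¹)).prod := by
    intro t ht
    -- After factoring out `-t`, each root contributes `t r - 1 = r (t - r⁻¹)`, and the factors `r`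
    -- multiply to 1.
    have e : t • M - 1 = (-t) • (Matrix.scalar (Fin n) t⁻¹ - M) := by
      rw [smul_sub, Matrix.scalar_apply, ← Matrix.smul_one_eq_diagonal, smul_smul, neg_mul,
        mul_inv_cancel₀ ht, neg_smul, neg_smul, one_smul]
      abel
    have e2 : (-t) ^ n = (s.map (fun _ => -t)).prod := by
      rw [Multiset.map_const', Multiset.prod_replicate, hcard]
    rw [e, Matrix.det_smul, hp, Fintype.card_fin, e2, ← Multiset.prod_map_mul,
      ← one_mul (s.map (fun r => t - r⁻¹)).prod, ← hprod]
    conv_rhs => rw [← Multiset.map_id' s]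
    rw [Multiset.map_map, ← Multiset.prod_map_mul]
    refine congrArg Multiset.prod (Multiset.map_congr rfl fun r hr => ?_)
    have hr0 : r ≠ 0 := fun h => h0 (h ▸ hr)
    simp only [Function.comp]
    field_simp
    ring
  have hpoly : ((s.map (starRingEnd ℂ)).map (fun r => Polynomial.X - Polynomial.C r)).prod
      = ((s.map (fun r => r⁻¹)).map (fun r => Polynomial.X - Polynomial.C r)).prod := by
    refine Polynomial.eq_of_infinite_eval_eq _ _ ?_
    refine (Set.finite_singleton (0 : ℂ)).infinite_compl.mono fun t ht => ?_
    have := h t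
    rw [hconj, hrev t ht] at this
    simp only [Set.mem_ofPred_eq, Polynomial.eval_multiset_prod, Multiset.map_map]
    simpa [Function.comp_def] using this
  have hroots := congrArg Polynomial.roots hpoly
  rw [Polynomial.roots_multiset_prod_X_sub_C, Polynomial.roots_multiset_prod_X_sub_C] at hroots
  have := congrArg (Multiset.map (starRingEnd ℂ)) hroots
  rw [Multiset.map_map, Multiset.map_map] at this
  simp only [Function.comp_def, Complex.conj_conj, Multiset.map_id', map_inv₀] at this
  exact this.symm

/-- The eigenvalues of `M ^ 2` are the squares of those of `M`. -/
theorem trace_sq_eq_sum_sq_roots (M : Matrix (Fin n) (Fin n) ℂ) :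
    (M ^ 2).trace = (M.charpoly.roots.map (· ^ 2)).sum := by
  set s := M.charpoly.roots with hs
  have hcard : s.card = n := by
    rw [hs, Polynomial.splits_iff_card_roots.1 (IsAlgClosed.splits M.charpoly),
      M.charpoly_natDegree_eq_dim, Fintype.card_fin]
  have hp : ∀ t, (Matrix.scalar (Fin n) t - M).det = (s.map (fun r => t - r)).prod := by
    intro t
    rw [← Matrix.eval_charpoly, (IsAlgClosed.splits M.charpoly).eval_eq_prod_roots_of_monic
      M.charpoly_monic]
  have hpoly : (M ^ 2).charpoly
      = ((s.map (· ^ 2)).map (fun r => Polynomial.X - Polynomial.C r)).prod := by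
    -- Every complex `z` is a square `t ^ 2`, and `t² - M² = -(t - M) (-t - M)` splits the
    -- determinant.
    refine Polynomial.funext fun z => ?_
    obtain ⟨t, rfl⟩ := IsAlgClosed.exists_pow_nat_eq z (n := 2) two_pos
    have e : Matrix.scalar (Fin n) (t ^ 2) - M ^ 2
        = (-1 : ℂ) • ((Matrix.scalar (Fin n) t - M) * (Matrix.scalar (Fin n) (-t) - M)) := by
      simp only [Matrix.scalar_apply, ← Matrix.smul_one_eq_diagonal, Matrix.sub_mul,
        Matrix.mul_sub, Matrix.smul_mul, Matrix.mul_smul, Matrix.one_mul, Matrix.mul_one,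
        smul_sub, smul_smul, pow_two]
      simp
      abel
    rw [Matrix.eval_charpoly, e, Matrix.det_smul, Matrix.det_mul, hp, hp, Fintype.card_fin]
    have e2 : (-1 : ℂ) ^ n = (s.map (fun _ => (-1 : ℂ))).prod := by
      rw [Multiset.map_const', Multiset.prod_replicate, hcard]
    rw [e2, ← Multiset.prod_map_mul, ← Multiset.prod_map_mul, Polynomial.eval_multiset_prod,
      Multiset.map_map, Multiset.map_map]
    refine congrArg Multiset.prod (Multiset.map_congr rfl fun r hr => ?_)
    simp
    ring
  rw [Matrix.trace_eq_sum_roots_charpoly, hpoly, Polynomial.roots_multiset_prod_X_sub_C]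

end Symmetry

-- The monodromy matrices at `lam` and `-lam`.

section Monodromy

variable {n : ℕ} {A : ℝ → ℂ → Matrix (Fin n) (Fin n) ℂ} {T : ℝ} {S : Set ℂ}
  {V : ℝ → ℂ → Matrix (Fin n) (Fin n) ℂ}

/-- `B` may be singular at `lam` and need not be continuous. The identity holds in a punctured
neighbourhood, where `B` is nonsingular, and both sides are continuous in the parameter. -/
theorem det_scalar_sub_monodromy_neg (hT : 0 ≤ T) (hS : S.Finite)
    (hSneg : ∀ lam ∈ S, -lam ∈ S)
    (hcont : ContinuousOn (fun p : ℝ × ℂ => A p.1 p.2) (Set.univ ×ˢ Sᶜ))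
    (hA2 : ∃ B : ℂ → Matrix (Fin n) (Fin n) ℂ, {lam | (B lam).det = 0}.Finite ∧
      ∀ x, ∀ lam ∉ S, (A x lam).transpose * B lam = -(B lam * A x (-lam)))
    (htr : ∀ x, ∀ lam ∉ S, (A x lam).trace = 0)
    (hV : ∀ lam ∉ S, IsFundamentalMatrix (fun x => A x lam) (fun x => V x lam))
    {lam : ℂ} (hlam : lam ∉ S) (t : ℂ) :
    (Matrix.scalar (Fin n) t - V T (-lam)).det = (t • V T lam - 1).det := by
  obtain ⟨B, hB, hAB⟩ := hA2
  have hneg : ∀ l ∉ S, -l ∉ S := fun l hl h => hl (by simpa using hSneg _ h)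
  have hSo : IsOpen Sᶜ := hS.isClosed.isOpen_compl
  have c1 : ContinuousAt (fun l => V T l) lam := continuousAt_fundamentalMatrix hSo hcont hV hT hlam
  have c2 : ContinuousAt (fun l => V T (-l)) lam :=
    ContinuousAt.comp (f := fun l => -l) (g := fun l => V T l)
      (continuousAt_fundamentalMatrix hSo hcont hV hT (hneg lam hlam)) continuous_neg.continuousAt
  have d1 : ContinuousAt (fun l => (t • V T l - 1).det) lam := by
    have : Continuous fun X : Matrix (Fin n) (Fin n) ℂ => (t • X - 1).det := by fun_prop
    exact this.continuousAt.comp c1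
  have d2 : ContinuousAt (fun l => (Matrix.scalar (Fin n) t - V T (-l)).det) lam := by
    have : Continuous fun X : Matrix (Fin n) (Fin n) ℂ => (Matrix.scalar (Fin n) t - X).det := by
      fun_prop
    exact this.continuousAt.comp c2
  have hev : ∀ᶠ l in 𝓝[≠] lam, (Matrix.scalar (Fin n) t - V T (-l)).det
      = (t • V T l - 1).det := by
    have h1 : ∀ᶠ l in 𝓝[≠] lam, l ∉ {lam | (B lam).det = 0} := by
      have := (hB.subset (Set.sdiff_subset (t := {lam}))).isClosed.isOpen_compl.mem_nhds
        (show lam ∈ ({lam | (B lam).det = 0} \ {lam})ᶜ by simp)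
      filter_upwards [nhdsWithin_le_nhds this, self_mem_nhdsWithin] with l hl hl'
      exact fun h => hl ⟨h, hl'⟩
    filter_upwards [h1, nhdsWithin_le_nhds (hSo.mem_nhds hlam)] with l hl hlS
    exact det_scalar_sub_monodromy (hV l hlS) (hV (-l) (hneg l hlS)) (fun x => htr x l hlS) hl
      (fun x => hAB x l hlS) T t
  exact tendsto_nhds_unique_of_eventuallyEq (d2.mono_left nhdsWithin_le_nhds)
    (d1.mono_left nhdsWithin_le_nhds) hev

/-- Here `-lam = conj lam`, so reflection makes both sides solutions of the same initial value
problem. -/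
theorem monodromy_neg_eq_conj (hS : S.Finite) (hSneg : ∀ lam ∈ S, -lam ∈ S)
    (hhol : ∀ x i j, DifferentiableOn ℂ (fun lam => A x lam i j) Sᶜ)
    (hA1 : ∀ x, ∀ r : ℝ, (r : ℂ) ∉ S → ∀ i j, (A x r i j).im = 0)
    (htr : ∀ x, ∀ lam ∉ S, (A x lam).trace = 0)
    (hV : ∀ lam ∉ S, IsFundamentalMatrix (fun x => A x lam) (fun x => V x lam))
    {lam : ℂ} (hlam : lam ∉ S) (hre : lam.re = 0) (x : ℝ) :
    V x (-lam) = (V x lam).map conj := by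
  have hneg : -lam ∉ S := fun h => hlam (by simpa using hSneg _ h)
  have hc : conj lam = -lam := by
    apply Complex.ext <;> simp [hre]
  have hA : ∀ y, A y (-lam) = (A y lam).map conj := by
    intro y
    ext i j
    rw [← hc]
    exact conj_eq_of_real hS (hhol y i j) (fun r hr => hA1 y r hr i j) hlam (hc ▸ hneg)
  have := (hV _ hneg).eq_mul (fun y => htr y _ hneg) (X := fun y => (V y lam).map conj)
    (fun y => ((hV lam hlam).hasEntryDeriv y).map_conj.congr (by rw [hA, Matrix.map_mul])) x
  rw [this, show V 0 lam = 1 from (hV lam hlam).1]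
  simp

end Monodromy

end Floquet

-- Algebraic multiplicity as a count of Floquet multipliers.

namespace Floquet

section Multiplicity

open Module

theorem finrank_biSup_of_iSupIndep {K E ι : Type*} [Field K] [AddCommGroup E] [Module K E]
    [FiniteDimensional K E] {G : ι → Submodule K E} (hG : iSupIndep G) (s : Finset ι) :
    finrank K (⨆ i ∈ s, G i : Submodule K E) = ∑ i ∈ s, finrank K (G i) := by
  classical
  induction s using Finset.induction_on with
  | empty => simp
  | insert a s ha ih =>
    rw [Finset.iSup_insert, Finset.sum_insert ha, ← ih, ← Submodule.finrank_sup_add_finrank_inf_eq]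
    have : Disjoint (G a) (⨆ i ∈ s, G i) := hG.disjoint_biSup (y := (s : Set ι)) ha
    rw [this.eq_bot]
    simp

/-- Generalized eigenspaces are independent, each has the algebraic multiplicity as its dimension,
and only the finitely many roots contribute. -/
theorem finrank_biSup_maxGenEigenspace {n : ℕ} (M : Matrix (Fin n) (Fin n) ℂ) :
    finrank ℂ (⨆ μ ∈ {μ : ℂ | ‖μ‖ = 1}, Module.End.maxGenEigenspace (Matrix.toLin' M) μ :
      Submodule ℂ (Fin n → ℂ)) = unitCircleCount M := by
  classical
  have hroot : ∀ μ, finrank ℂ (Module.End.maxGenEigenspace (Matrix.toLin' M) μ)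
      = M.charpoly.rootMultiplicity μ := by
    intro μ
    rw [LinearMap.finrank_maxGenEigenspace_eq, ← Matrix.charpoly_toLin']
  set F := M.charpoly.roots.toFinset.filter (fun μ => ‖μ‖ = 1) with hF
  have e : (⨆ μ ∈ {μ : ℂ | ‖μ‖ = 1}, Module.End.maxGenEigenspace (Matrix.toLin' M) μ)
      = ⨆ μ ∈ F, Module.End.maxGenEigenspace (Matrix.toLin' M) μ := by
    apply le_antisymm
    · refine iSup₂_le fun μ hμ => ?_
      by_cases h : μ ∈ F
      · exact le_iSup₂_of_le μ h le_rfl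
      · have h0 : M.charpoly.rootMultiplicity μ = 0 := by
          rw [← Polynomial.count_roots, Multiset.count_eq_zero]
          intro h'
          exact h (Finset.mem_filter.2 ⟨Multiset.mem_toFinset.2 h', hμ⟩)
        rw [Submodule.finrank_eq_zero.1 ((hroot μ).trans h0)]
        exact bot_le
    · refine iSup₂_le fun μ hμ => ?_
      exact le_iSup₂_of_le μ (Finset.mem_filter.1 hμ).2 le_rfl
  rw [e, finrank_biSup_of_iSupIndep (Module.End.independent_maxGenEigenspace _)]
  simp only [hroot, unitCircleCount]
  have e2 : F = (M.charpoly.roots.filter (fun μ => ‖μ‖ = 1)).toFinset := by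
    rw [hF, Multiset.toFinset_filter]
  rw [e2]
  have h3 := Multiset.toFinset_sum_count_eq (M.charpoly.roots.filter (fun μ => ‖μ‖ = 1))
  convert h3 using 1
  · refine Finset.sum_congr rfl fun μ hμ => ?_
    rw [Multiset.count_filter_of_pos (p := fun μ : ℂ => ‖μ‖ = 1)
      (Multiset.mem_filter.1 (Multiset.mem_toFinset.1 hμ)).2,
      Polynomial.count_roots]

theorem mulVec_mem_solutionSpace {n : ℕ} {A V : ℝ → Matrix (Fin n) (Fin n) ℂ}
    (hV : IsFundamentalMatrix A V) (c : Fin n → ℂ) :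
    (fun x => V x *ᵥ c) ∈ solutionSpace A := by
  intro x
  rw [hasDerivAt_pi]
  intro i
  rw [Matrix.mulVec_mulVec]
  have := HasDerivAt.fun_sum (u := Finset.univ) fun j _ => (hV.2 x i j).mul_const (c j)
  exact this

theorem eq_mulVec_of_mem_solutionSpace {n : ℕ} {A V : ℝ → Matrix (Fin n) (Fin n) ℂ}
    (hV : IsFundamentalMatrix A V) (htr : ∀ x, (A x).trace = 0) {v : ℝ → Fin n → ℂ}
    (hv : v ∈ solutionSpace A) (x : ℝ) : v x = V x *ᵥ v 0 := by
  have h := hV.eq_mul htr (X := fun x => Matrix.replicateCol Unit (v x)) (fun y i j => by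
    exact (hasDerivAt_pi.1 (hv y)) i) x
  ext i
  exact congrFun (congrFun h i) ()

/-- The algebraic multiplicity counts the Floquet multipliers on the unit circle. -/
theorem essMultiplicity_eq_unitCircleCount {n : ℕ} {A : ℝ → ℂ → Matrix (Fin n) (Fin n) ℂ} {T : ℝ}
    {lam : ℂ} {V : ℝ → Matrix (Fin n) (Fin n) ℂ}
    (hV : IsFundamentalMatrix (fun x => A x lam) V) (htr : ∀ x, (A x lam).trace = 0)
    (hper : ∀ x, A (x + T) lam = A x lam) :
    essMultiplicity A T lam = unitCircleCount (V T) := by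
  -- `φ` parametrizes solutions by their initial values; `V (x + T) = V x * V T` makes it intertwine
  -- `V T` with the translation.
  let φ : (Fin n → ℂ) →ₗ[ℂ] (ℝ → Fin n → ℂ) :=
    { toFun := fun c x => V x *ᵥ c
      map_add' := fun c d => by ext x; simp [Matrix.mulVec_add]
      map_smul' := fun a c => by ext x; simp [Matrix.mulVec_smul] }
  have hφ : Function.Injective φ := by
    intro c d h
    have := congrFun h 0
    simpa [φ, hV.1] using this
  have hcomm : ∀ μ : ℂ, ∀ k : ℕ, ∀ c,
      ((translation n T - μ • (1 : Module.End ℂ (ℝ → Fin n → ℂ)) :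
        Module.End ℂ (ℝ → Fin n → ℂ)) ^ k) (φ c)
        = φ (((Matrix.toLin' (V T) - μ • (1 : Module.End ℂ (Fin n → ℂ)) :
          Module.End ℂ (Fin n → ℂ)) ^ k) c) := by
    intro μ k
    induction k with
    | zero => intro c; rfl
    | succ k ih =>
      intro c
      rw [pow_succ, pow_succ, Module.End.mul_apply, Module.End.mul_apply, ← ih]
      congr 1
      ext x i
      simp only [LinearMap.sub_apply, LinearMap.smul_apply, Module.End.one_apply, map_sub, map_smul,
        Matrix.toLin'_apply]
      simp only [φ, translation, LinearMap.coe_mk, AddHom.coe_mk, Pi.sub_apply]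
      rw [hV.add_period htr hper, Matrix.mulVec_mulVec]
  have key : ∀ μ : ℂ, (translation n T).maxGenEigenspace μ ⊓ solutionSpace (fun x => A x lam)
      = (Module.End.maxGenEigenspace (Matrix.toLin' (V T)) μ).map φ := by
    intro μ
    ext v
    simp only [Submodule.mem_inf, Module.End.mem_maxGenEigenspace, Submodule.mem_map]
    constructor
    · rintro ⟨⟨k, hk⟩, hv⟩
      have e : v = φ (v 0) := funext fun x => eq_mulVec_of_mem_solutionSpace hV htr hv x
      refine ⟨v 0, ⟨k, hφ ?_⟩, e.symm⟩
      rw [← hcomm, ← e, hk, map_zero]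
    · rintro ⟨c, ⟨k, hk⟩, rfl⟩
      exact ⟨⟨k, by rw [hcomm, hk, map_zero]⟩, mulVec_mem_solutionSpace hV c⟩
  unfold essMultiplicity
  have e : (⨆ μ ∈ {μ : ℂ | ‖μ‖ = 1},
      (translation n T).maxGenEigenspace μ ⊓ solutionSpace (fun x => A x lam))
      = (⨆ μ ∈ {μ : ℂ | ‖μ‖ = 1}, Module.End.maxGenEigenspace (Matrix.toLin' (V T)) μ).map φ := by
    rw [Submodule.map_iSup]
    refine iSup_congr fun μ => ?_
    rw [Submodule.map_iSup]
    exact iSup_congr fun _ => key μ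
  rw [e, ← finrank_biSup_maxGenEigenspace]
  exact (Submodule.equivMapOfInjective φ hφ _).finrank_eq.symm

end Multiplicity

end Floquet

-- Weak derivatives and pairing with adjoint solutions.

namespace Floquet

section Analysis

open scoped ENNReal NNReal
open Set

/-- Local integrability on the line, in the form used for interval integrals. -/
def LocInt (h : ℝ → ℂ) : Prop := ∀ a b, IntervalIntegrable h volume a b

theorem LocInt.continuous_mul {f h : ℝ → ℂ} (hh : LocInt h) (hf : Continuous f) :
    LocInt (fun x => f x * h x) := fun a b => (hh a b).continuousOn_mul hf.continuousOn

theorem LocInt.sum {ι : Type*} {s : Finset ι} {h : ι → ℝ → ℂ} (hh : ∀ i, LocInt (h i)) :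
    LocInt (fun x => ∑ i ∈ s, h i x) := fun a b => by
  have := IntervalIntegrable.sum s (f := h) fun i _ => hh i a b
  simpa [Finset.sum_fn] using this

theorem LocInt.continuous_primitive {h : ℝ → ℂ} (hh : LocInt h) (c : ℂ) :
    Continuous (fun x => c + ∫ s in (0 : ℝ)..x, h s) :=
  continuous_const.add (intervalIntegral.continuous_primitive hh 0)

theorem _root_.AbsolutelyContinuousOnInterval.ofReal {f : ℝ → ℝ} {a b : ℝ}
    (hf : AbsolutelyContinuousOnInterval f a b) :
    AbsolutelyContinuousOnInterval (fun x => (f x : ℂ)) a b := by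
  have h1 : AbsolutelyContinuousOnInterval (fun _ : ℝ => (1 : ℂ)) a b :=
    contDiff_const.contDiffOn.absolutelyContinuousOnInterval
  have e : (fun x => (f x : ℂ)) = f • fun _ : ℝ => (1 : ℂ) := by
    funext x
    simp [Pi.smul_apply']
  rw [e]
  exact hf.smul h1

theorem LocInt.absolutelyContinuous_primitive {h : ℝ → ℂ} (hh : LocInt h) (x : ℝ) :
    AbsolutelyContinuousOnInterval (fun y => ∫ s in (0 : ℝ)..y, h s) 0 x := by
  have hre : IntervalIntegrable (fun s => (h s).re) volume 0 x :=
    ⟨(hh 0 x).1.re, (hh 0 x).2.re⟩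
  have him : IntervalIntegrable (fun s => (h s).im) volume 0 x :=
    ⟨(hh 0 x).1.im, (hh 0 x).2.im⟩
  have h1 := (hre.absolutelyContinuousOnInterval_intervalIntegral (c := 0) left_mem_uIcc).ofReal
  have h2 := ((him.absolutelyContinuousOnInterval_intervalIntegral
    (c := 0) left_mem_uIcc).ofReal).const_smul Complex.I
  have e : (fun y => ∫ s in (0 : ℝ)..y, h s)
      = (fun y => ((∫ s in (0 : ℝ)..y, (h s).re : ℝ) : ℂ))
        + fun y => Complex.I • ((∫ s in (0 : ℝ)..y, (h s).im : ℝ) : ℂ) := by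
    funext y
    have e1 : ((∫ s in (0 : ℝ)..y, (h s).re : ℝ) : ℂ) = ((∫ s in (0 : ℝ)..y, h s).re : ℂ) :=
      congrArg _ (Complex.reCLM.intervalIntegral_comp_comm (hh 0 y))
    have e2 : ((∫ s in (0 : ℝ)..y, (h s).im : ℝ) : ℂ) = ((∫ s in (0 : ℝ)..y, h s).im : ℂ) :=
      congrArg _ (Complex.imCLM.intervalIntegral_comp_comm (hh 0 y))
    simp only [Pi.add_apply, e1, e2, smul_eq_mul]
    rw [mul_comm, Complex.re_add_im]
  rw [e]
  exact h1.add h2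

/-- Product rule for a continuously differentiable and an absolutely continuous function. -/
theorem mul_primitive_eq {f f' h : ℝ → ℂ} (hf : ∀ x, HasDerivAt f (f' x) x) (hf' : Continuous f')
    (hh : LocInt h) (c : ℂ) (x : ℝ) :
    f x * (c + ∫ s in (0 : ℝ)..x, h s)
      = f 0 * c + ∫ s in (0 : ℝ)..x, (f' s * (c + ∫ t in (0 : ℝ)..s, h t) + f s * h s) := by
  have hfc : Continuous f := continuous_iff_continuousAt.2 fun x => (hf x).continuousAt
  set k : ℝ → ℂ := fun s => f' s * (c + ∫ t in (0 : ℝ)..s, h t) + f s * h s with hk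
  have hkint : LocInt k := fun a b =>
    ((hf'.mul (hh.continuous_primitive c)).intervalIntegrable a b).add
      (hh.continuous_mul hfc a b)
  have hfac : AbsolutelyContinuousOnInterval f 0 x := by
    refine ContDiffOn.absolutelyContinuousOnInterval (ContDiff.contDiffOn ?_)
    rw [contDiff_one_iff_deriv]
    refine ⟨fun x => (hf x).differentiableAt, ?_⟩
    rw [show deriv f = f' from funext fun x => (hf x).deriv]
    exact hf'
  have hconst : AbsolutelyContinuousOnInterval (fun _ : ℝ => c) 0 x :=
    contDiff_const.contDiffOn.absolutelyContinuousOnInterval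
  -- The difference of the two sides is absolutely continuous with derivative zero almost
  -- everywhere, hence constant.
  have hG : AbsolutelyContinuousOnInterval (fun y => f y * (c + ∫ s in (0 : ℝ)..y, h s)
      - ∫ s in (0 : ℝ)..y, k s) 0 x :=
    (hfac.smul (hconst.add (hh.absolutelyContinuous_primitive x))).sub
      (hkint.absolutelyContinuous_primitive x)
  obtain ⟨C, hC⟩ := hG.const_of_ae_hasDerivAt_zero (by
    filter_upwards [(hh 0 x).ae_hasDerivAt_integral, (hkint 0 x).ae_hasDerivAt_integral]
      with y h1 h2 hy
    have d1 := h1 hy 0 left_mem_uIcc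
    have d2 := h2 hy 0 left_mem_uIcc
    have d3 := ((hf y).mul (d1.const_add c)).sub d2
    exact d3.congr_deriv (sub_eq_zero.2 rfl))
  have e0 := hC 0 left_mem_uIcc
  have e1 := hC x right_mem_uIcc
  rw [← e0] at e1
  simp only [intervalIntegral.integral_same, add_zero, sub_zero] at e1
  rw [← e1]
  ring

variable {n : ℕ}

theorem locInt_coord (w : L2 n) (i : Fin n) : LocInt (fun s => w s i) := fun a b => by
  have := intervalIntegrable_L2 w a b
  exact ⟨(EuclideanSpace.proj (𝕜 := ℂ) i).integrable_comp this.1,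
    (EuclideanSpace.proj (𝕜 := ℂ) i).integrable_comp this.2⟩

theorem integral_coord (w : L2 n) (i : Fin n) (a b : ℝ) :
    (∫ s in a..b, w s) i = ∫ s in a..b, w s i :=
  ((EuclideanSpace.proj (𝕜 := ℂ) i).intervalIntegral_comp_comm
    (intervalIntegrable_L2 w a b)).symm

/-- Pairing with a solution of the adjoint equation turns `u' = A u + g` into a quadrature. -/
theorem ae_adjoint_pairing {A : ℝ → Matrix (Fin n) (Fin n) ℂ} (hA : Continuous A) {z : ℝ → Fin n → ℂ}
    (hz : ∀ x i, HasDerivAt (fun y => z y i) (-(z x ᵥ* A x) i) x) {u g : L2 n}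
    (hug : (u, g) ∈ opGraph A) :
    ∃ k : ℂ, ∀ᵐ x : ℝ, ∑ i, z x i * u x i = k + ∫ s in (0 : ℝ)..x, ∑ i, z s i * g s i := by
  obtain ⟨w, ⟨c, hu⟩, hg⟩ := hug
  have hzc : Continuous z := continuous_pi fun i =>
    continuous_iff_continuousAt.2 fun x => (hz x i).continuousAt
  have hzc' : ∀ i, Continuous fun x => -(z x ᵥ* A x) i := fun i =>
    ((continuous_apply i).comp (hzc.matrix_vecMul hA)).neg
  refine ⟨∑ i, z 0 i * c i, ?_⟩
  have hu' : ∀ᵐ x : ℝ, ∀ i, u x i = c i + ∫ s in (0 : ℝ)..x, w s i := by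
    filter_upwards [hu] with x hx i
    rw [hx, PiLp.add_apply, integral_coord]
  filter_upwards [hu'] with x hx
  simp only [hx]
  -- After the product rule the integrand is `-(z A) · u + z · w`; with `w = A u + g` the terms
  -- containing `A` cancel.
  simp only [mul_primitive_eq (fun x => hz x _) (hzc' _) (locInt_coord w _)]
  rw [Finset.sum_add_distrib, ← intervalIntegral.integral_finsetSum]
  · congr 1
    refine intervalIntegral.integral_congr_ae ?_
    filter_upwards [hu', hg] with s hs hgs _
    have e : ∀ i, g s i = w s i - (A s *ᵥ (u s).ofLp) i := fun i => by
      have : g s = w s - WithLp.toLp 2 (A s *ᵥ (u s).ofLp) := hgs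
      rw [this]; rfl
    simp only [e, mul_sub, Finset.sum_sub_distrib, Finset.sum_add_distrib, ← hs, neg_mul,
      Finset.sum_neg_distrib]
    have := Matrix.dotProduct_mulVec (z s) (A s) (u s).ofLp
    simp only [dotProduct] at this
    rw [this]
    ring
  · intro i _
    exact (((hzc' i).mul ((locInt_coord w i).continuous_primitive (c i))).intervalIntegrable _ _).add
      ((locInt_coord w i).continuous_mul ((continuous_apply i).comp hzc) _ _)

/-- By Chebyshev's inequality `{δ ≤ ‖u‖}` has finite measure. -/
theorem not_ae_le_norm_of_L2 (u : L2 n) {δ : ℝ} (hδ : 0 < δ) {s : Set ℝ} (hs : volume s = ∞) :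
    ¬ ∀ᵐ x : ℝ, x ∈ s → δ ≤ ‖u x‖ := by
  intro h
  have h1 := (Lp.memLp u).meas_ge_lt_top (by norm_num) (by norm_num) (ε := ⟨δ, hδ.le⟩)
    (fun h => hδ.ne' (congrArg NNReal.toReal h))
  refine absurd (hs.symm.le.trans (measure_mono_ae ?_)) (not_le.2 h1)
  filter_upwards [h] with x hx hxs
  exact hx hxs

end Analysis

end Floquet

-- Translation invariance, and multipliers on the unit circle.

namespace Floquet

section Shift

open scoped ENNReal NNReal
open Set

variable {n : ℕ}

/-- Translation as a linear isometry of `L²`. -/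
def shift (T : ℝ) : L2 n →ₗᵢ[ℂ] L2 n :=
  Lp.compMeasurePreservingₗᵢ ℂ (· + T) (measurePreserving_add_right volume T)

theorem shift_ae (T : ℝ) (u : L2 n) : ∀ᵐ x : ℝ, shift T u x = u (x + T) :=
  Lp.coeFn_compMeasurePreserving u (measurePreserving_add_right volume T)

theorem ae_add_right {p : ℝ → Prop} (h : ∀ᵐ x : ℝ, p x) (T : ℝ) : ∀ᵐ x : ℝ, p (x + T) :=
  (measurePreserving_add_right volume T).quasiMeasurePreserving.ae h

theorem shift_neg_shift (T : ℝ) (u : L2 n) : shift (-T) (shift T u) = u := by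
  apply Lp.ext
  filter_upwards [shift_ae (-T) (shift T u), ae_add_right (shift_ae T u) (-T)] with x h1 h2
  rw [h1, h2, neg_add_cancel_right]

theorem HasL2Deriv.shift {u w : L2 n} (h : HasL2Deriv u w) (T : ℝ) :
    HasL2Deriv (shift T u) (shift T w) := by
  obtain ⟨c, hc⟩ := h
  refine ⟨c + ∫ s in (0 : ℝ)..T, w s, ?_⟩
  filter_upwards [shift_ae T u, ae_add_right hc T] with x h1 h2
  have e : ∫ s in (0 : ℝ)..x, (Floquet.shift T w) s = ∫ s in (0 : ℝ)..x, w (s + T) :=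
    intervalIntegral.integral_congr_ae (by filter_upwards [shift_ae T w] with s hs _ using hs)
  rw [h1, h2, e, intervalIntegral.integral_comp_add_right (fun s => w s), zero_add, add_assoc,
    intervalIntegral.integral_add_adjacent_intervals (intervalIntegrable_L2 w _ _)
      (intervalIntegrable_L2 w _ _)]

theorem shift_mem_opRange {A : ℝ → Matrix (Fin n) (Fin n) ℂ} {T : ℝ}
    (hper : ∀ x, A (x + T) = A x) {g : L2 n} (hg : g ∈ opRange A) : shift T g ∈ opRange A := by
  obtain ⟨⟨u, g'⟩, ⟨w, hw, hu⟩, rfl⟩ := hg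
  refine ⟨(shift T u, shift T g'), ⟨shift T w, hw.shift T, ?_⟩, rfl⟩
  filter_upwards [shift_ae T u, shift_ae T g', shift_ae T w, ae_add_right hu T] with x h1 h2 h3 h4
  have h5 : g' (x + T) = w (x + T) - WithLp.toLp 2 (A (x + T) *ᵥ (u (x + T)).ofLp) := h4
  change shift T g' x = shift T w x - WithLp.toLp 2 (A x *ᵥ (shift T u x).ofLp)
  rw [h1, h2, h3, h5, hper]

/-- Translation is an isometry, so a nonzero `h` forces `‖ν‖ = 1`. Then `‖h‖` is periodic, which is
incompatible with a finite nonzero `L²` norm. -/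
theorem eq_zero_of_shift_eq_smul {T : ℝ} (hT : 0 < T) {h : L2 n} {ν : ℂ}
    (hν : shift T h = ν • h) : h = 0 := by
  by_contra h0
  have hν1 : ‖ν‖ = 1 := by
    have := (shift T).norm_map h
    rw [hν, norm_smul] at this
    exact mul_right_cancel₀ (norm_ne_zero_iff.2 h0) (by rw [this, one_mul])
  set F : ℝ → ℝ≥0∞ := fun x => ‖h x‖ₑ ^ (2 : ℝ) with hF
  have hFper : ∀ᵐ x : ℝ, F (x + T) = F x := by
    filter_upwards [shift_ae T h, Lp.coeFn_smul ν h] with x h1 h2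
    rw [hν, h2] at h1
    simp only [hF, ← h1, Pi.smul_apply, enorm_smul]
    rw [← ofReal_norm ν, hν1]
    simp
  have hFmeas : AEMeasurable F volume :=
    ((Lp.memLp h).aestronglyMeasurable.enorm).pow_const _
  have hFint : ∫⁻ x, F x < ∞ := by
    have := lintegral_rpow_enorm_lt_top_of_eLpNorm_lt_top (p := 2) (by norm_num) (by norm_num)
      (Lp.memLp h).2
    simpa [hF] using this
  have hzero : ∀ a : ℝ, ∀ᵐ x : ℝ, x ∈ Ioc a (a + T) → F x = 0 := by
    intro a
    -- By periodicity the tails from `a` and from `a + T` have equal, finite integrals, so the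
    -- period between them contributes nothing.
    have e1 : ∫⁻ x in Ioi (a + T), F x = ∫⁻ x in Ioi a, F x := by
      rw [← (measurePreserving_add_right volume T).setLIntegral_comp_preimage_emb
        (measurableEmbedding_addRight T)]
      simp only [preimage_add_const_Ioi, add_sub_cancel_right]
      exact lintegral_congr_ae (ae_restrict_of_ae hFper)
    have e2 : ∫⁻ x in Ioi a, F x = (∫⁻ x in Ioc a (a + T), F x) + ∫⁻ x in Ioi (a + T), F x := by
      rw [← lintegral_union measurableSet_Ioi (by
        rw [Set.disjoint_left]; intro x hx hx'; exact not_lt.2 hx.2 hx'),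
        Ioc_union_Ioi_eq_Ioi (by linarith)]
    have e3 : ∫⁻ x in Ioi a, F x ≠ ∞ := ((setLIntegral_le_lintegral _ _).trans_lt hFint).ne
    rw [e1] at e2
    have e4 : ∫⁻ x in Ioc a (a + T), F x = 0 := by
      have : 0 + ∫⁻ x in Ioi a, F x = (∫⁻ x in Ioc a (a + T), F x) + ∫⁻ x in Ioi a, F x := by
        rw [zero_add]; exact e2
      exact ((ENNReal.add_left_inj e3).1 this).symm
    rw [lintegral_eq_zero_iff' hFmeas.restrict] at e4
    exact (ae_restrict_iff' measurableSet_Ioc).1 e4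
  have hall : ∀ᵐ x : ℝ, ∀ k : ℤ, x ∈ Ioc (0 + k • T) (0 + k • T + T) → F x = 0 :=
    ae_all_iff.2 fun k => hzero _
  apply h0
  apply Lp.ext
  filter_upwards [hall, Lp.coeFn_zero (EuclideanSpace ℂ (Fin n)) 2 (volume : Measure ℝ)]
    with x hx h2
  rw [h2, Pi.zero_apply]
  have hxu : x ∈ ⋃ k : ℤ, Ioc (0 + k • T) (0 + (k + 1) • T) := by
    rw [iUnion_Ioc_add_zsmul hT]; trivial
  obtain ⟨k, hk⟩ := mem_iUnion.1 hxu
  have := hx k (by rwa [add_smul, one_smul, ← add_assoc] at hk)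
  simpa [hF] using this

/-- For a periodic problem, a closed range of finite codimension is the whole space. -/
theorem opRange_eq_top_of_isFredholm {A : ℝ → Matrix (Fin n) (Fin n) ℂ} {T : ℝ} (hT : 0 < T)
    (hper : ∀ x, A (x + T) = A x) (hF : IsFredholm A) : opRange A = ⊤ := by
  obtain ⟨-, hclosed, hfin⟩ := hF
  have : CompleteSpace (opRange A) := hclosed.completeSpace_coe
  have : FiniteDimensional ℂ (opRange A)ᗮ :=
    (Submodule.quotientEquivOfIsCompl _ _
      (Submodule.isCompl_orthogonal (K := opRange A))).finiteDimensional
  by_contra hne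
  have hbot : (opRange A)ᗮ ≠ ⊥ := fun h => hne ((Submodule.orthogonal_eq_bot_iff).1 h)
  have : Nontrivial (opRange A)ᗮ := Submodule.nontrivial_iff_ne_bot.2 hbot
  -- The range is invariant under the unitary `shift T`, so its orthogonal complement is invariant
  -- under the inverse `shift (-T)`. If nonzero, this finite-dimensional space would contain an
  -- eigenvector.
  have hmaps : ∀ h ∈ (opRange A)ᗮ, shift (-T) h ∈ (opRange A)ᗮ := by
    intro h hh
    rw [Submodule.mem_orthogonal] at hh ⊢
    intro g hg
    rw [← shift_neg_shift T g, (shift (-T)).inner_map_map]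
    exact hh _ (shift_mem_opRange hper hg)
  obtain ⟨ν, hν⟩ := Module.End.exists_eigenvalue
    ((shift (-T)).toLinearMap.restrict hmaps : Module.End ℂ (opRange A)ᗮ)
  obtain ⟨⟨h, hh⟩, hev, hne0⟩ := hν.exists_hasEigenvector
  have e1 : shift (-T) h = ν • h := congrArg Subtype.val (Module.End.mem_eigenspace_iff.1 hev)
  have hh0 : h ≠ 0 := fun e => hne0 (Subtype.ext e)
  have hν0 : ν ≠ 0 := by
    rintro rfl
    rw [zero_smul] at e1
    exact hh0 ((shift (-T)).injective (by rw [e1, map_zero]))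
  refine hh0 (eq_zero_of_shift_eq_smul hT (ν := ν⁻¹) ?_)
  have e2 := congrArg (shift T) e1
  have e3 := shift_neg_shift (-T) h
  rw [neg_neg] at e3
  rw [e3, map_smul] at e2
  rw [eq_inv_smul_iff₀ hν0]
  exact e2.symm

/-- Exponential bound for functions that are periodic up to a multiplier. -/
theorem exists_norm_le_exp {E : Type*} [NormedAddCommGroup E] [NormedSpace ℂ E] {f : ℝ → E}
    (hf : Continuous f) {T : ℝ} (hT : 0 < T) {ν : ℂ} (hν : ν ≠ 0)
    (hper : ∀ x, f (x + T) = ν • f x) :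
    ∃ C : ℝ, 0 < C ∧ ∀ x, ‖f x‖ ≤ C * Real.exp (Real.log ‖ν‖ / T * x) := by
  set p : ℝ → ℝ := fun x => Real.exp (-(Real.log ‖ν‖ / T * x)) * ‖f x‖ with hp
  have hpper : Function.Periodic p T := by
    intro x
    simp only [hp, hper, norm_smul]
    rw [mul_add, neg_add, Real.exp_add, div_mul_cancel₀ _ hT.ne', Real.exp_neg (Real.log ‖ν‖),
      Real.exp_log (norm_pos_iff.2 hν)]
    have := norm_ne_zero_iff.2 hν
    field_simp
  have hpc : Continuous p := by fun_prop
  obtain ⟨C, hC⟩ := (hpper.isBounded_of_continuous hT.ne' hpc).exists_norm_le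
  refine ⟨|C| + 1, by positivity, fun x => ?_⟩
  have h1 : p x ≤ |C| + 1 := by
    have := hC (p x) (mem_range_self x)
    rw [Real.norm_eq_abs] at this
    linarith [le_abs_self (p x), le_abs_self C]
  calc ‖f x‖ = p x * Real.exp (Real.log ‖ν‖ / T * x) := by
        simp only [hp]
        rw [mul_right_comm, ← Real.exp_add, neg_add_cancel, Real.exp_zero, one_mul]
    _ ≤ _ := mul_le_mul_of_nonneg_right h1 (Real.exp_pos _).le

theorem norm_sum_mul_le (z : Fin n → ℂ) (u : EuclideanSpace ℂ (Fin n)) :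
    ‖∑ i, z i * u i‖ ≤ n * ‖z‖ * ‖u‖ := by
  calc ‖∑ i, z i * u i‖ ≤ ∑ i, ‖z i * u i‖ := norm_sum_le _ _
    _ ≤ ∑ _i : Fin n, ‖z‖ * ‖u‖ := Finset.sum_le_sum fun i _ => by
        rw [norm_mul]
        exact mul_le_mul (norm_le_pi_norm z i) (PiLp.norm_apply_le u i) (norm_nonneg _)
          (norm_nonneg _)
    _ = n * ‖z‖ * ‖u‖ := by simp; ring

/-- A quantity bounded by an `L²` function cannot be a nonzero constant on a set of infinite
measure. -/
theorem eq_zero_of_ae_norm_le (u : L2 n) {s : Set ℝ} (hs : volume s = ∞) {k : ℂ} {C : ℝ}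
    (h : ∀ᵐ x : ℝ, x ∈ s → ‖k‖ ≤ C * ‖u x‖) : k = 0 := by
  by_contra hk
  have hk' : 0 < ‖k‖ := norm_pos_iff.2 hk
  refine not_ae_le_norm_of_L2 u (δ := ‖k‖ / (|C| + 1)) (by positivity) hs ?_
  filter_upwards [h] with x hx hxs
  rw [div_le_iff₀ (by positivity)]
  have h1 := hx hxs
  have h2 : C * ‖u x‖ ≤ |C| * ‖u x‖ := mul_le_mul_of_nonneg_right (le_abs_self C) (norm_nonneg _)
  linarith [norm_nonneg (u x)]

theorem _root_.Matrix.exists_vecMul_eq_smul_of_mem_roots {M : Matrix (Fin n) (Fin n) ℂ} {μ : ℂ}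
    (h : μ ∈ M.charpoly.roots) : ∃ q : Fin n → ℂ, q ≠ 0 ∧ q ᵥ* M = μ • q := by
  have h1 : (Matrix.scalar (Fin n) μ - M).det = 0 := by
    rw [← Matrix.eval_charpoly]
    exact (Polynomial.mem_roots'.1 h).2
  obtain ⟨q, hq, hq'⟩ := Matrix.exists_vecMul_eq_zero_iff.2 h1
  refine ⟨q, hq, ?_⟩
  rw [Matrix.vecMul_sub, sub_eq_zero, Matrix.scalar_apply, ← Matrix.smul_one_eq_diagonal,
    Matrix.vecMul_smul, Matrix.vecMul_one] at hq'
  exact hq'.symm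

section Adjoint

variable {A V : ℝ → Matrix (Fin n) (Fin n) ℂ}

theorem hasDerivAt_adjoint (hV : IsFundamentalMatrix A V) (htr : ∀ x, (A x).trace = 0)
    (q : Fin n → ℂ) (x : ℝ) (i : Fin n) :
    HasDerivAt (fun y => (q ᵥ* (V y)⁻¹) i) (-((q ᵥ* (V x)⁻¹) ᵥ* A x) i) x := by
  rw [Matrix.vecMul_vecMul]
  have := HasDerivAt.fun_sum (u := Finset.univ) fun j _ =>
    (hV.hasEntryDeriv_inv htr x j i).const_mul (q j)
  refine this.congr_deriv ?_
  simp [Matrix.vecMul, dotProduct]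

theorem continuous_adjoint (hV : IsFundamentalMatrix A V) (htr : ∀ x, (A x).trace = 0)
    (q : Fin n → ℂ) : Continuous fun y => q ᵥ* (V y)⁻¹ :=
  continuous_pi fun i => continuous_iff_continuousAt.2 fun x =>
    (hasDerivAt_adjoint hV htr q x i).continuousAt

theorem adjoint_add_period (hV : IsFundamentalMatrix A V) (htr : ∀ x, (A x).trace = 0) {T : ℝ}
    (hper : ∀ x, A (x + T) = A x) {q : Fin n → ℂ} {μ : ℂ} (hμ : μ ≠ 0)
    (hq : q ᵥ* V T = μ • q) (x : ℝ) :
    q ᵥ* (V (x + T))⁻¹ = μ⁻¹ • (q ᵥ* (V x)⁻¹) := by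
  have h1 : q ᵥ* (V T)⁻¹ = μ⁻¹ • q := by
    rw [eq_inv_smul_iff₀ hμ, ← Matrix.smul_vecMul, ← hq, Matrix.vecMul_vecMul, hV.mul_inv htr,
      Matrix.vecMul_one]
  rw [hV.add_period htr hper, Matrix.mul_inv_rev, ← Matrix.vecMul_vecMul, h1, Matrix.smul_vecMul]

/-- A Floquet multiplier on the unit circle destroys the Fredholm property. -/
theorem not_isFredholm_of_norm_eq_one (hA : Continuous A) (hV : IsFundamentalMatrix A V)
    (htr : ∀ x, (A x).trace = 0) {T : ℝ} (hT : 0 < T) (hper : ∀ x, A (x + T) = A x) {μ : ℂ}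
    (hμ : μ ∈ (V T).charpoly.roots) (hμ1 : ‖μ‖ = 1) : ¬ IsFredholm A := by
  intro hF
  have htop := opRange_eq_top_of_isFredholm hT hper hF
  obtain ⟨q, hq0, hq⟩ := Matrix.exists_vecMul_eq_smul_of_mem_roots hμ
  have hμ0 : μ ≠ 0 := norm_ne_zero_iff.1 (by rw [hμ1]; exact one_ne_zero)
  set z : ℝ → Fin n → ℂ := fun y => q ᵥ* (V y)⁻¹ with hz
  have hzc : Continuous z := continuous_adjoint hV htr q
  have hz0 : ∀ x, z x ≠ 0 := by
    intro x h
    apply hq0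
    have : (q ᵥ* (V x)⁻¹) ᵥ* V x = 0 := by
      rw [show q ᵥ* (V x)⁻¹ = 0 from h, Matrix.zero_vecMul]
    rwa [Matrix.vecMul_vecMul, hV.inv_mul htr, Matrix.vecMul_one] at this
  obtain ⟨C, hC0, hC⟩ := exists_norm_le_exp hzc hT (inv_ne_zero hμ0)
    (adjoint_add_period hV htr hper hμ0 hq)
  have hC' : ∀ x, ‖z x‖ ≤ C := fun x => by simpa [hμ1] using hC x
  -- a compactly supported right-hand side without a square integrable solution
  have hgc : Continuous fun x => (WithLp.toLp 2 (star (z x)) : EuclideanSpace ℂ (Fin n)) := by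
    fun_prop
  have hgmem : MemLp ((Ioc 0 T).indicator
      fun x => (WithLp.toLp 2 (star (z x)) : EuclideanSpace ℂ (Fin n))) 2 volume := by
    rw [memLp_indicator_iff_restrict measurableSet_Ioc]
    obtain ⟨K, hK⟩ := isCompact_Icc.exists_bound_of_continuousOn (s := Icc 0 T) hgc.continuousOn
    refine MemLp.of_bound hgc.aestronglyMeasurable K ?_
    exact (ae_restrict_iff' measurableSet_Ioc).2
      (Filter.Eventually.of_forall fun x hx => hK x (Ioc_subset_Icc_self hx))
  obtain ⟨⟨u, g⟩, hug, hg⟩ : hgmem.toLp _ ∈ opRange A := htop ▸ trivial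
  have hg : g = hgmem.toLp _ := hg
  -- With `g = star z` on `(0, T]`, the pairing `z · u` equals `k` to the left of 0 and `k + ∫₀ᵀ
  -- |z|²` to the right of `T`. As `z` is bounded and `u` is in `L²`, both constants must vanish,
  -- although the integral is positive.
  obtain ⟨k, hk⟩ := ae_adjoint_pairing hA (hasDerivAt_adjoint hV htr q) hug
  have hint : ∀ x, ∫ s in (0 : ℝ)..x, ∑ i, z s i * g s i
      = ∫ s in (0 : ℝ)..x, (Ioc 0 T).indicator
          (fun s => ((∑ i, Complex.normSq (z s i) : ℝ) : ℂ)) s := by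
    intro x
    refine intervalIntegral.integral_congr_ae ?_
    filter_upwards [hgmem.coeFn_toLp] with s hs _
    rw [hg, hs]
    by_cases h : s ∈ Ioc 0 T
    · simp [h, Complex.mul_conj]
    · simp [h]
  have hSc : Continuous fun s => ∑ i, Complex.normSq (z s i) := by
    have := Complex.continuous_normSq
    fun_prop
  have hpos : 0 < ∫ s in (0 : ℝ)..T, ∑ i, Complex.normSq (z s i) := by
    refine intervalIntegral.intervalIntegral_pos_of_pos (hSc.intervalIntegrable _ _) (fun s => ?_) hT
    obtain ⟨i, hi⟩ := Function.ne_iff.1 (hz0 s)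
    exact Finset.sum_pos' (fun _ _ => Complex.normSq_nonneg _)
      ⟨i, Finset.mem_univ i, Complex.normSq_pos.2 hi⟩
  have hneg : ∀ x ≤ (0 : ℝ), ∫ s in (0 : ℝ)..x, ∑ i, z s i * g s i = 0 := by
    intro x hx
    rw [hint, intervalIntegral.integral_zero_ae]
    refine Filter.Eventually.of_forall fun s hs => ?_
    rw [uIoc_of_ge hx] at hs
    exact indicator_of_notMem (fun h => not_lt.2 hs.2 h.1) _
  have hposx : ∀ x, T ≤ x → ∫ s in (0 : ℝ)..x, ∑ i, z s i * g s i
      = ((∫ s in (0 : ℝ)..T, ∑ i, Complex.normSq (z s i) : ℝ) : ℂ) := by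
    intro x hx
    rw [hint, intervalIntegral.integral_of_le (hT.le.trans hx),
      setIntegral_indicator measurableSet_Ioc, inter_eq_self_of_subset_right
        (Ioc_subset_Ioc_right hx), ← intervalIntegral.integral_of_le hT.le,
      intervalIntegral.integral_ofReal]
  have hk0 : k = 0 := by
    refine eq_zero_of_ae_norm_le u (s := Iic 0) (C := n * C) (by simp) ?_
    filter_upwards [hk] with x hx hxs
    rw [hneg x hxs, add_zero] at hx
    rw [← hx]
    refine (norm_sum_mul_le _ _).trans ?_
    gcongr
    exact hC' x
  have hk1 : k + ((∫ s in (0 : ℝ)..T, ∑ i, Complex.normSq (z s i) : ℝ) : ℂ) = 0 := by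
    refine eq_zero_of_ae_norm_le u (s := Ici T) (C := n * C) (by simp) ?_
    filter_upwards [hk] with x hx hxs
    rw [hposx x hxs] at hx
    rw [← hx]
    refine (norm_sum_mul_le _ _).trans ?_
    gcongr
    exact hC' x
  rw [hk0, zero_add] at hk1
  exact hpos.ne' (Complex.ofReal_eq_zero.1 hk1)

end Adjoint

end Shift

end Floquet

-- Exponential dichotomy and invertibility.

namespace Floquet

section Dichotomy

open scoped ENNReal NNReal
open Set

/-- The exponential kernel. -/
def expKernel (β : ℝ) (t : ℝ) : ℝ≥0∞ := ENNReal.ofReal (Real.exp (-β * |t|))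

theorem measurable_expKernel (β : ℝ) : Measurable (expKernel β) := by
  unfold expKernel
  fun_prop

theorem lintegral_expKernel_lt_top {β : ℝ} (hβ : 0 < β) : ∫⁻ t, expKernel β t < ∞ := by
  have h1 : IntegrableOn (fun t : ℝ => Real.exp (-β * |t|)) (Ioi 0) :=
    (integrableOn_exp_mul_Ioi (neg_lt_zero.2 hβ) 0).congr_fun
      (fun t ht => by simp only [abs_of_pos (show 0 < t from ht)]) measurableSet_Ioi
  have h2 : IntegrableOn (fun t : ℝ => Real.exp (-β * |t|)) (Iic 0) :=
    (integrableOn_exp_mul_Iic hβ 0).congr_fun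
      (fun t ht => by simp only [abs_of_nonpos (show t ≤ 0 from ht), neg_mul_neg]) measurableSet_Iic
  have h3 : Integrable (fun t : ℝ => Real.exp (-β * |t|)) := by
    rw [← integrableOn_univ, ← Iic_union_Ioi (a := (0 : ℝ))]
    exact h2.union h1
  have := h3.lintegral_lt_top
  exact this

theorem expKernel_le_one {β : ℝ} (hβ : 0 < β) (t : ℝ) : expKernel β t ≤ 1 := by
  unfold expKernel
  rw [ENNReal.ofReal_le_one, Real.exp_le_one_iff]
  nlinarith [abs_nonneg t]

/-- Convolution with the exponential kernel. -/
def expConv (β : ℝ) (γ : ℝ → ℝ≥0∞) (x : ℝ) : ℝ≥0∞ := ∫⁻ s, expKernel β (x - s) * γ s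

/-- Cauchy–Schwarz, with the kernel split into two square roots. -/
theorem sq_expConv_le (β : ℝ) {γ : ℝ → ℝ≥0∞} (hγ : Measurable γ) (x : ℝ) :
    expConv β γ x ^ (2 : ℝ)
      ≤ (∫⁻ t, expKernel β t) * ∫⁻ s, expKernel β (x - s) * γ s ^ (2 : ℝ) := by
  have hk : Measurable fun s => expKernel β (x - s) :=
    (measurable_expKernel β).comp (measurable_const.sub measurable_id)
  have h := ENNReal.lintegral_mul_le_Lp_mul_Lq volume Real.HolderConjugate.two_two
    (f := fun s => expKernel β (x - s) ^ (1 / 2 : ℝ))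
    (g := fun s => expKernel β (x - s) ^ (1 / 2 : ℝ) * γ s)
    (hk.pow_const _).aemeasurable ((hk.pow_const _).mul hγ).aemeasurable
  have e1 : ∀ s, expKernel β (x - s) ^ (1 / 2 : ℝ) * expKernel β (x - s) ^ (1 / 2 : ℝ)
      = expKernel β (x - s) := fun s => by
    rw [← ENNReal.rpow_add_of_nonneg _ _ (by norm_num) (by norm_num)]; norm_num
  have e2 : ∀ s, (expKernel β (x - s) ^ (1 / 2 : ℝ)) ^ (2 : ℝ) = expKernel β (x - s) := fun s => by
    rw [← ENNReal.rpow_mul]; norm_num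
  simp only [Pi.mul_apply, ← mul_assoc, e1, e2, ENNReal.mul_rpow_of_nonneg _ _ zero_le_two] at h
  rw [lintegral_sub_left_eq_self (expKernel β) x] at h
  have h' := ENNReal.rpow_le_rpow h zero_le_two
  refine h'.trans (le_of_eq ?_)
  rw [ENNReal.mul_rpow_of_nonneg _ _ zero_le_two, ← ENNReal.rpow_mul, ← ENNReal.rpow_mul]
  norm_num

theorem expConv_lt_top {β : ℝ} (hβ : 0 < β) {γ : ℝ → ℝ≥0∞} (hγ : Measurable γ)
    (hγ2 : ∫⁻ s, γ s ^ (2 : ℝ) < ∞) (x : ℝ) : expConv β γ x < ∞ := by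
  have h := sq_expConv_le β hγ x
  have h2 : ∫⁻ s, expKernel β (x - s) * γ s ^ (2 : ℝ) ≤ ∫⁻ s, γ s ^ (2 : ℝ) :=
    lintegral_mono fun s => mul_le_of_le_one_left' (expKernel_le_one hβ _)
  have h3 : expConv β γ x ^ (2 : ℝ) < ∞ :=
    h.trans_lt (ENNReal.mul_lt_top (lintegral_expKernel_lt_top hβ) (h2.trans_lt hγ2))
  exact (ENNReal.rpow_lt_top_iff_of_pos two_pos).1 h3

/-- Young's inequality for an `L¹` kernel: the pointwise bound is integrated by Tonelli's theorem,
giving the square of the kernel's mass. -/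
theorem lintegral_sq_expConv_lt_top {β : ℝ} (hβ : 0 < β) {γ : ℝ → ℝ≥0∞} (hγ : Measurable γ)
    (hγ2 : ∫⁻ s, γ s ^ (2 : ℝ) < ∞) : ∫⁻ x, expConv β γ x ^ (2 : ℝ) < ∞ := by
  have hm : Measurable (fun p : ℝ × ℝ => expKernel β (p.1 - p.2) * γ p.2 ^ (2 : ℝ)) :=
    ((measurable_expKernel β).comp (measurable_fst.sub measurable_snd)).mul
      ((hγ.comp measurable_snd).pow_const _)
  calc ∫⁻ x, expConv β γ x ^ (2 : ℝ)
      ≤ ∫⁻ x, (∫⁻ t, expKernel β t) * ∫⁻ s, expKernel β (x - s) * γ s ^ (2 : ℝ) :=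
        lintegral_mono fun x => sq_expConv_le β hγ x
    _ = (∫⁻ t, expKernel β t) * ∫⁻ x, ∫⁻ s, expKernel β (x - s) * γ s ^ (2 : ℝ) :=
        lintegral_const_mul' _ _ (lintegral_expKernel_lt_top hβ).ne
    _ = (∫⁻ t, expKernel β t) * ∫⁻ s, ∫⁻ x, expKernel β (x - s) * γ s ^ (2 : ℝ) := by
        rw [lintegral_lintegral_swap hm.aemeasurable]
    _ = (∫⁻ t, expKernel β t) * ∫⁻ s, (∫⁻ t, expKernel β t) * γ s ^ (2 : ℝ) := by
        congr 1
        refine lintegral_congr fun s => ?_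
        have hm' : Measurable fun x => expKernel β (x - s) :=
          (measurable_expKernel β).comp (measurable_id.sub_const s)
        rw [lintegral_mul_const _ hm', lintegral_sub_right_eq_self (expKernel β) s]
    _ = (∫⁻ t, expKernel β t) * ((∫⁻ t, expKernel β t) * ∫⁻ s, γ s ^ (2 : ℝ)) := by
        rw [lintegral_const_mul _ (hγ.pow_const _)]
    _ < ∞ := ENNReal.mul_lt_top (lintegral_expKernel_lt_top hβ)
        (ENNReal.mul_lt_top (lintegral_expKernel_lt_top hβ) hγ2)

/-- On `J`, `exp (-α s) = exp (-α x) * exp (-|α| |x - s|)`. `J` will be the half-line from `x` on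
which the weight decays. -/
theorem setLIntegral_enorm_le {ζ : ℝ → ℂ} {γ : ℝ → ℝ≥0∞} {K α : ℝ}
    (hζ : ∀ s, ‖ζ s‖ₑ ≤ ENNReal.ofReal (K * Real.exp (-α * s)) * γ s) (hK : 0 ≤ K)
    {J : Set ℝ} (hJm : MeasurableSet J) {x : ℝ} (hJ : ∀ s ∈ J, α * (s - x) = |α| * |x - s|) :
    ∫⁻ s in J, ‖ζ s‖ₑ ≤ ENNReal.ofReal (K * Real.exp (-α * x)) * expConv |α| γ x := by
  calc ∫⁻ s in J, ‖ζ s‖ₑ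
      ≤ ∫⁻ s in J, ENNReal.ofReal (K * Real.exp (-α * x)) * (expKernel |α| (x - s) * γ s) := by
        refine setLIntegral_mono' hJm fun s hs => (hζ s).trans (le_of_eq ?_)
        rw [← mul_assoc, expKernel, ← ENNReal.ofReal_mul (by positivity), mul_assoc,
          ← Real.exp_add]
        congr 4
        have := hJ s hs
        linarith
    _ ≤ ∫⁻ s, ENNReal.ofReal (K * Real.exp (-α * x)) * (expKernel |α| (x - s) * γ s) :=
        setLIntegral_le_lintegral _ _
    _ = _ := lintegral_const_mul' _ _ ENNReal.ofReal_ne_top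

/-- A primitive of an exponentially weighted function with the inverse weight. -/
theorem exists_primitive_le_expConv {ζ : ℝ → ℂ} (hζi : LocInt ζ) {γ : ℝ → ℝ≥0∞}
    (hγ : Measurable γ) (hγ2 : ∫⁻ s, γ s ^ (2 : ℝ) < ∞) {K α : ℝ} (hα : α ≠ 0)
    (hζm : AEStronglyMeasurable ζ volume) (hK : 0 ≤ K)
    (hζ : ∀ s, ‖ζ s‖ₑ ≤ ENNReal.ofReal (K * Real.exp (-α * s)) * γ s) :
    ∃ c : ℂ, ∀ x, ‖c + ∫ s in (0 : ℝ)..x, ζ s‖ₑ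
      ≤ ENNReal.ofReal (K * Real.exp (-α * x)) * expConv |α| γ x := by
  have hfin : ∀ x, ENNReal.ofReal (K * Real.exp (-α * x)) * expConv |α| γ x < ∞ := fun x =>
    ENNReal.mul_lt_top ENNReal.ofReal_lt_top (expConv_lt_top (abs_pos.2 hα) hγ hγ2 x)
  -- The constant makes the primitive start at the end where the weight decays: `-∞` for `α < 0`,
  -- `+∞` for `α > 0`.
  rcases lt_or_gt_of_ne hα with h | h
  · have hb : ∀ x, ∫⁻ s in Iic x, ‖ζ s‖ₑ
        ≤ ENNReal.ofReal (K * Real.exp (-α * x)) * expConv |α| γ x := fun x =>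
      setLIntegral_enorm_le hζ hK measurableSet_Iic fun s hs => by
        rw [abs_of_neg h, abs_of_nonneg (sub_nonneg.2 hs)]; ring
    have hint : ∀ x, IntegrableOn ζ (Iic x) volume := fun x =>
      ⟨hζm.restrict, (hb x).trans_lt (hfin x)⟩
    refine ⟨∫ s in Iic 0, ζ s, fun x => ?_⟩
    rw [← intervalIntegral.integral_Iic_sub_Iic (hint 0) (hint x), add_sub_cancel]
    exact (enorm_integral_le_lintegral_enorm _).trans (hb x)
  · have hb : ∀ x, ∫⁻ s in Ioi x, ‖ζ s‖ₑ
        ≤ ENNReal.ofReal (K * Real.exp (-α * x)) * expConv |α| γ x := fun x =>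
      setLIntegral_enorm_le hζ hK measurableSet_Ioi fun s hs => by
        rw [abs_of_pos h, abs_of_neg (sub_neg.2 hs)]; ring
    have hint : ∀ x, IntegrableOn ζ (Ioi x) volume := fun x =>
      ⟨hζm.restrict, (hb x).trans_lt (hfin x)⟩
    refine ⟨-∫ s in Ioi 0, ζ s, fun x => ?_⟩
    rw [← intervalIntegral.integral_interval_add_Ioi' (hζi 0 x) (hint x), neg_add_rev,
      neg_add_cancel_right, enorm_neg]
    exact (enorm_integral_le_lintegral_enorm _).trans (hb x)

variable {n : ℕ} {ι : Type*} [Fintype ι]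

/-- Solvability of `u' = A u + g` in `L²` for a system with an exponential dichotomy. -/
theorem mem_opRange_of_dichotomy {A : ℝ → Matrix (Fin n) (Fin n) ℂ} (hA : Continuous A)
    {K : ℝ} (hK : ∀ x i j, ‖A x i j‖ ≤ K) {v z : ι → ℝ → Fin n → ℂ}
    (hv : ∀ j, v j ∈ solutionSpace A) (hz : ∀ j, Continuous (z j))
    (hvz : ∀ x (i k : Fin n), ∑ j, v j x i * z j x k = if i = k then 1 else 0) {α : ι → ℝ}
    (hα : ∀ j, α j ≠ 0) {C : ι → ℝ} (hC : ∀ j, 0 ≤ C j)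
    (hvC : ∀ j x, ‖v j x‖ ≤ C j * Real.exp (α j * x))
    (hzC : ∀ j x, ‖z j x‖ ≤ C j * Real.exp (-α j * x)) (g : L2 n) : g ∈ opRange A := by
  set γ : ℝ → ℝ≥0∞ := fun s => ‖g s‖ₑ with hγdef
  have hγ : Measurable γ := (Lp.stronglyMeasurable g).enorm
  have hγ2 : ∫⁻ s, γ s ^ (2 : ℝ) < ∞ := by
    have := lintegral_rpow_enorm_lt_top_of_eLpNorm_lt_top (p := 2) (by norm_num) (by norm_num)
      (Lp.memLp g).2
    simpa [hγdef] using this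
  set ζ : ι → ℝ → ℂ := fun j s => ∑ i, z j s i * g s i with hζdef
  have hζi : ∀ j, LocInt (ζ j) := fun j =>
    LocInt.sum fun i => (locInt_coord g i).continuous_mul ((continuous_apply i).comp (hz j))
  have hgi : ∀ i, AEStronglyMeasurable (fun s => g s i) volume := fun i =>
    (EuclideanSpace.proj (𝕜 := ℂ) i).continuous.comp_aestronglyMeasurable
      (Lp.aestronglyMeasurable g)
  have hζm : ∀ j, AEStronglyMeasurable (ζ j) volume := fun j =>
    Finset.aestronglyMeasurable_fun_sum _ fun i _ =>
      ((continuous_apply i).comp (hz j)).aestronglyMeasurable.mul (hgi i)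
  have hζb : ∀ j s, ‖ζ j s‖ₑ ≤ ENNReal.ofReal ((n * C j) * Real.exp (-α j * s)) * γ s := by
    intro j s
    have h1 : ‖ζ j s‖ ≤ (n * C j) * Real.exp (-α j * s) * ‖g s‖ := by
      refine (norm_sum_mul_le _ _).trans ?_
      rw [mul_assoc (n : ℝ) (C j)]
      gcongr
      exact hzC j s
    have := hC j
    rw [← ofReal_norm, hγdef]
    simp only
    rw [← ofReal_norm (g s), ← ENNReal.ofReal_mul (by positivity)]
    exact ENNReal.ofReal_le_ofReal h1
  -- Variation of constants: the solution is `∑ j, v j * y j`, with `y j` the primitive of `z j · g`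
  -- that is controlled on the whole line.
  choose c hc using fun j => exists_primitive_le_expConv (hζi j) hγ hγ2 (hα j) (hζm j)
    (mul_nonneg (Nat.cast_nonneg n) (hC j)) (hζb j)
  set y : ι → ℝ → ℂ := fun j x => c j + ∫ s in (0 : ℝ)..x, ζ j s with hy
  have hyc : ∀ j, Continuous (y j) := fun j => (hζi j).continuous_primitive _
  have hvc : ∀ j, Continuous (v j) := fun j =>
    continuous_iff_continuousAt.2 fun x => (hv j x).continuousAt
  set U : ℝ → EuclideanSpace ℂ (Fin n) := fun x => WithLp.toLp 2 fun i => ∑ j, v j x i * y j x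
    with hU
  have hUmem : MemLp U 2 volume := by
    rw [memLp_piLp_iff]
    intro i
    refine memLp_finsetSum (f := fun j x => v j x i * y j x) _ fun j _ => ?_
    have hcont : Continuous fun x => v j x i * y j x :=
      ((continuous_apply i).comp (hvc j)).mul (hyc j)
    refine ⟨hcont.aestronglyMeasurable, ?_⟩
    refine (eLpNorm_lt_top_iff_lintegral_rpow_enorm_lt_top (by norm_num) (by norm_num)).2 ?_
    -- The growth `exp (α j x)` of `v j` cancels the weight in the bound for `y j`, leaving a
    -- convolution in `L²`.
    have hb : ∀ x, ‖v j x i * y j x‖ₑ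
        ≤ ENNReal.ofReal (n * C j * C j) * expConv |α j| γ x := by
      intro x
      rw [enorm_mul]
      have h1 : ‖v j x i‖ₑ ≤ ENNReal.ofReal (C j * Real.exp (α j * x)) := by
        rw [← ofReal_norm]
        exact ENNReal.ofReal_le_ofReal ((norm_le_pi_norm _ i).trans (hvC j x))
      refine (mul_le_mul' h1 (hc j x)).trans (le_of_eq ?_)
      have := hC j
      rw [← mul_assoc, ← ENNReal.ofReal_mul (by positivity)]
      congr 2
      have : Real.exp (α j * x) * Real.exp (-α j * x) = 1 := by
        rw [← Real.exp_add, neg_mul, add_neg_cancel, Real.exp_zero]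
      linear_combination (n * C j * C j) * this
    calc ∫⁻ x, ‖v j x i * y j x‖ₑ ^ (2 : ℝ≥0∞).toReal
        ≤ ∫⁻ x, ENNReal.ofReal (n * C j * C j) ^ (2 : ℝ) * expConv |α j| γ x ^ (2 : ℝ) := by
          refine lintegral_mono fun x => ?_
          rw [← ENNReal.mul_rpow_of_nonneg _ _ zero_le_two]
          simpa using ENNReal.rpow_le_rpow (hb x) zero_le_two
      _ = ENNReal.ofReal (n * C j * C j) ^ (2 : ℝ) * ∫⁻ x, expConv |α j| γ x ^ (2 : ℝ) :=
          lintegral_const_mul' _ _ (by simp)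
      _ < ∞ := ENNReal.mul_lt_top (by simp)
          (lintegral_sq_expConv_lt_top (abs_pos.2 (hα j)) hγ hγ2)
  have hUc : ∀ i, Continuous fun x => U x i := fun i => by
    simp only [hU]
    exact continuous_finsetSum _ fun j _ => ((continuous_apply i).comp (hvc j)).mul (hyc j)
  have hAij : ∀ i k, Continuous fun x => A x i k := fun i k =>
    (continuous_apply k).comp ((continuous_apply i).comp hA)
  set W : ℝ → EuclideanSpace ℂ (Fin n) := fun x => WithLp.toLp 2 (A x *ᵥ (U x).ofLp) + g x with hW
  have hAUmem : MemLp (fun x => (WithLp.toLp 2 (A x *ᵥ (U x).ofLp) : EuclideanSpace ℂ (Fin n)))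
      2 volume := by
    rw [memLp_piLp_iff]
    intro i
    change MemLp (fun x => ∑ k, A x i k * U x k) 2 volume
    refine memLp_finsetSum (f := fun k x => A x i k * U x k) _ fun k _ => ?_
    refine MemLp.of_le_mul (c := K) ((memLp_piLp_iff.1 hUmem) k)
      ((hAij i k).mul (hUc k)).aestronglyMeasurable (Filter.Eventually.of_forall fun x => ?_)
    rw [norm_mul]
    exact mul_le_mul_of_nonneg_right (hK x i k) (norm_nonneg _)
  have hWmem : MemLp W 2 volume := hAUmem.add (Lp.memLp g)
  refine ⟨(hUmem.toLp U, g), ⟨hWmem.toLp W, ⟨U 0, ?_⟩, ?_⟩, rfl⟩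
  · filter_upwards [hUmem.coeFn_toLp] with x hx
    have hWint : ∫ s in (0 : ℝ)..x, (hWmem.toLp W) s = ∫ s in (0 : ℝ)..x, W s :=
      intervalIntegral.integral_congr_ae
        (by filter_upwards [hWmem.coeFn_toLp] with s hs _ using hs)
    change (hUmem.toLp U) x = _
    rw [hx]
    ext i
    rw [PiLp.add_apply, integral_coord]
    have hWi : ∫ s in (0 : ℝ)..x, (hWmem.toLp W) s i = ∫ s in (0 : ℝ)..x, W s i :=
      intervalIntegral.integral_congr_ae
        (by filter_upwards [hWmem.coeFn_toLp] with s hs _ using by rw [hs])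
    rw [hWi]
    have hvd : ∀ j y, HasDerivAt (fun x => v j x i) ((A y *ᵥ v j y) i) y := fun j y =>
      hasDerivAt_pi.1 (hv j y) i
    have hvd' : ∀ j, Continuous fun x => (A x *ᵥ v j x) i := fun j =>
      (continuous_apply i).comp (hA.matrix_mulVec (hvc j))
    have hprod := fun j => mul_primitive_eq (hvd j) (hvd' j) (hζi j) (c j) x
    have e1 : U x i = ∑ j, (v j 0 i * c j + ∫ s in (0 : ℝ)..x,
        ((A s *ᵥ v j s) i * (c j + ∫ t in (0 : ℝ)..s, ζ j t) + v j s i * ζ j s)) := by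
      simp only [hU, hy, hprod]
    have e2 : U 0 i = ∑ j, v j 0 i * c j := by simp [hU, hy]
    rw [e1, Finset.sum_add_distrib, ← e2, ← intervalIntegral.integral_finsetSum]
    · congr 1
      refine intervalIntegral.integral_congr fun s _ => ?_
      -- The duality `∑ j, v j ⊗ z j = 1` recombines the components of `g`.
      have k1 : ∑ j, v j s i * ζ j s = g s i := by
        simp only [hζdef, Finset.mul_sum, ← mul_assoc]
        rw [Finset.sum_comm]
        simp only [← Finset.sum_mul, hvz]
        simp
      have k2 : ∑ j, (A s *ᵥ v j s) i * y j s = (A s *ᵥ (U s).ofLp) i := by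
        simp only [Matrix.mulVec, dotProduct, hU, Finset.sum_mul, Finset.mul_sum]
        rw [Finset.sum_comm]
        simp only [mul_assoc]
      simp only [Finset.sum_add_distrib, k1]
      exact congrArg (· + g s i) k2
    · intro j _
      exact (((hvd' j).mul (hyc j)).intervalIntegrable _ _).add
        ((hζi j).continuous_mul ((continuous_apply i).comp (hvc j)) _ _)
  · filter_upwards [hUmem.coeFn_toLp, hWmem.coeFn_toLp] with x h1 h2
    change g x = (hWmem.toLp W) x - WithLp.toLp 2 (A x *ᵥ ((hUmem.toLp U) x).ofLp)
    rw [h1, h2, hW]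
    simp

/-- For `u` in the kernel each `z j · u` is constant. As `z j` is bounded on a half-line and `u` is
in `L²`, the constant is 0, and duality recovers `u = 0`. -/
theorem opKer_eq_bot_of_dichotomy {A : ℝ → Matrix (Fin n) (Fin n) ℂ} (hA : Continuous A)
    {v z : ι → ℝ → Fin n → ℂ}
    (hz : ∀ j x i, HasDerivAt (fun y => z j y i) (-(z j x ᵥ* A x) i) x)
    (hvz : ∀ x (i k : Fin n), ∑ j, v j x i * z j x k = if i = k then 1 else 0) {α : ι → ℝ}
    (hα : ∀ j, α j ≠ 0) {C : ι → ℝ} (hC : ∀ j, 0 ≤ C j)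
    (hzC : ∀ j x, ‖z j x‖ ≤ C j * Real.exp (-α j * x)) : opKer A = ⊥ := by
  rw [eq_bot_iff]
  intro u hu
  have hu : (u, (0 : L2 n)) ∈ opGraph A := hu
  have hpair : ∀ j, ∀ᵐ x : ℝ, ∑ i, z j x i * u x i = 0 := by
    intro j
    obtain ⟨k, hk⟩ := ae_adjoint_pairing hA (hz j) hu
    have h0 : ∀ x, ∫ s in (0 : ℝ)..x, ∑ i, z j s i * (0 : L2 n) s i = 0 := fun x => by
      rw [intervalIntegral.integral_zero_ae]
      filter_upwards [Lp.coeFn_zero (EuclideanSpace ℂ (Fin n)) 2 (volume : Measure ℝ)] with s hs _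
      simp
    simp only [h0, add_zero] at hk
    have hbound : ∀ x, 0 ≤ α j * x → ‖z j x‖ ≤ C j := fun x hx =>
      (hzC j x).trans (mul_le_of_le_one_right (hC j) (Real.exp_le_one_iff.2 (by linarith)))
    have hk0 : k = 0 := by
      have main : ∀ s : Set ℝ, volume s = ∞ → (∀ x ∈ s, 0 ≤ α j * x) → k = 0 := by
        intro s hs hsα
        refine eq_zero_of_ae_norm_le u hs (C := n * C j) ?_
        filter_upwards [hk] with x hx hxs
        rw [← hx]
        refine (norm_sum_mul_le _ _).trans ?_
        gcongr
        exact hbound x (hsα x hxs)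
      rcases lt_or_gt_of_ne (hα j) with h | h
      · exact main (Iic 0) (by simp) fun x hx => mul_nonneg_of_nonpos_of_nonpos h.le hx
      · exact main (Ici 0) (by simp) fun x hx => mul_nonneg h.le hx
    rw [hk0] at hk
    exact hk
  have hall : ∀ᵐ x : ℝ, ∀ j, ∑ i, z j x i * u x i = 0 := ae_all_iff.2 hpair
  rw [Submodule.mem_bot]
  apply Lp.ext
  filter_upwards [hall, Lp.coeFn_zero (EuclideanSpace ℂ (Fin n)) 2 (volume : Measure ℝ)]
    with x hx h0
  rw [h0]
  ext k
  have e : ∑ j, v j x k * ∑ i, z j x i * u x i = u x k := by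
    simp only [Finset.mul_sum, ← mul_assoc]
    rw [Finset.sum_comm]
    simp only [← Finset.sum_mul, hvz]
    simp
  rw [← e]
  simp [hx]

theorem isFredholm_of_opKer_opRange {A : ℝ → Matrix (Fin n) (Fin n) ℂ} (hk : opKer A = ⊥)
    (hr : opRange A = ⊤) : IsFredholm A := by
  refine ⟨?_, ?_, ?_⟩
  · rw [hk]; infer_instance
  · rw [hr]; exact isClosed_univ
  · rw [hr]; infer_instance

/-- The operator is invertible if the Floquet multipliers are simple and off the unit circle. -/
theorem isFredholm_of_nodup {A V : ℝ → Matrix (Fin n) (Fin n) ℂ} (hA : Continuous A)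
    (hV : IsFundamentalMatrix A V) (htr : ∀ x, (A x).trace = 0) {T : ℝ} (hT : 0 < T)
    (hper : ∀ x, A (x + T) = A x) (hnodup : (V T).charpoly.roots.Nodup)
    (hoff : ∀ μ ∈ (V T).charpoly.roots, ‖μ‖ ≠ 1) : IsFredholm A := by
  set s := (V T).charpoly.roots with hs
  have hcard : s.card = n := by
    rw [hs, Polynomial.splits_iff_card_roots.1 (IsAlgClosed.splits _),
      (V T).charpoly_natDegree_eq_dim, Fintype.card_fin]
  obtain ⟨l, hl⟩ : ∃ l : List ℂ, (l : Multiset ℂ) = s := ⟨s.toList, s.coe_toList⟩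
  have hlen : l.length = n := by rw [← hcard, ← hl, Multiset.coe_card]
  have hlnd : l.Nodup := by rw [← hl] at hnodup; exact hnodup
  set μ : Fin n → ℂ := fun j => l.get (j.cast hlen.symm) with hμ
  have hμinj : Function.Injective μ := (List.nodup_iff_injective_get.1 hlnd).comp
    (Fin.cast_injective _)
  have hμs : ∀ j, μ j ∈ s := fun j => by rw [← hl]; exact List.get_mem _ _
  have hprod : s.prod = 1 := by
    rw [hs, ← Matrix.det_eq_prod_roots_charpoly, hV.det_eq_one htr]
  have hμ0 : ∀ j, μ j ≠ 0 := fun j h => by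
    have := hμs j
    rw [h] at this
    rw [Multiset.prod_eq_zero this] at hprod
    exact zero_ne_one hprod
  choose q hq0 hq using fun j => Matrix.exists_vecMul_eq_smul_of_mem_roots (hμs j)
  -- The rows of `Q` are left eigenvectors of `V T`, independent because the multipliers are
  -- distinct. The columns of `Q⁻¹` are the dual right eigenvectors and give the solutions `v j`.
  set Q : Matrix (Fin n) (Fin n) ℂ := Matrix.of q with hQ
  have hQu : IsUnit Q := by
    rw [← Matrix.linearIndependent_rows_iff_isUnit]
    refine Module.End.eigenvectors_linearIndependent' (Matrix.toLin' (V T)ᵀ) μ hμinj q fun j => ?_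
    refine Module.End.hasEigenvector_iff.2 ⟨Module.End.mem_eigenspace_iff.2 ?_, hq0 j⟩
    rw [Matrix.toLin'_apply, Matrix.mulVec_transpose, hq]
  have hdetQ : IsUnit Q.det := (Matrix.isUnit_iff_isUnit_det _).1 hQu
  have hQV : Q * V T = Matrix.diagonal μ * Q := by
    ext i k
    have := congrFun (hq i) k
    simpa [Matrix.mul_apply, Matrix.vecMul, dotProduct, hQ, Matrix.diagonal_apply] using this
  have hVQ : V T * Q⁻¹ = Q⁻¹ * Matrix.diagonal μ := by
    calc V T * Q⁻¹ = Q⁻¹ * (Q * V T) * Q⁻¹ := by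
          rw [← Matrix.mul_assoc Q⁻¹, Matrix.nonsing_inv_mul _ hdetQ, Matrix.one_mul]
      _ = Q⁻¹ * Matrix.diagonal μ := by
          rw [hQV, Matrix.mul_assoc, Matrix.mul_assoc, Matrix.mul_nonsing_inv _ hdetQ,
            Matrix.mul_one]
  set v : Fin n → ℝ → Fin n → ℂ := fun j x => V x *ᵥ (Q⁻¹)ᵀ j with hvdef
  set z : Fin n → ℝ → Fin n → ℂ := fun j x => q j ᵥ* (V x)⁻¹ with hzdef
  have hvsol : ∀ j, v j ∈ solutionSpace A := fun j => mulVec_mem_solutionSpace hV _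
  have hvper : ∀ j x, v j (x + T) = μ j • v j x := by
    intro j x
    simp only [hvdef]
    rw [hV.add_period htr hper, ← Matrix.mulVec_mulVec, ← Matrix.mulVec_smul]
    congr 1
    ext i
    have := congrFun (congrFun hVQ i) j
    rw [Matrix.mul_diagonal] at this
    rw [Pi.smul_apply, smul_eq_mul, mul_comm]
    exact this
  have hzc : ∀ j, Continuous (z j) := fun j => continuous_adjoint hV htr (q j)
  have hvz : ∀ x (i k : Fin n), ∑ j, v j x i * z j x k = if i = k then 1 else 0 := by
    intro x i k
    have e : (V x * Q⁻¹) * (Q * (V x)⁻¹) = 1 := by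
      rw [Matrix.mul_assoc, ← Matrix.mul_assoc Q⁻¹, Matrix.nonsing_inv_mul _ hdetQ, Matrix.one_mul,
        hV.mul_inv htr]
    have := congrFun (congrFun e i) k
    rw [Matrix.mul_apply, Matrix.one_apply] at this
    exact this
  -- Floquet exponents: nonzero exactly because no multiplier has modulus 1.
  set α : Fin n → ℝ := fun j => Real.log ‖μ j‖ / T with hαdef
  have hα : ∀ j, α j ≠ 0 := fun j => div_ne_zero
    (Real.log_ne_zero_of_pos_of_ne_one (norm_pos_iff.2 (hμ0 j)) (hoff _ (hμs j))) hT.ne'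
  choose C₁ hC₁ hvC using fun j => exists_norm_le_exp
    (continuous_iff_continuousAt.2 fun x => (hvsol j x).continuousAt) hT (hμ0 j) (hvper j)
  choose C₂ hC₂ hzC using fun j => exists_norm_le_exp (hzc j) hT (inv_ne_zero (hμ0 j))
    (adjoint_add_period hV htr hper (hμ0 j) (hq j))
  have hvC' : ∀ j x, ‖v j x‖ ≤ max (C₁ j) (C₂ j) * Real.exp (α j * x) := fun j x =>
    (hvC j x).trans (mul_le_mul_of_nonneg_right (le_max_left _ _) (Real.exp_pos _).le)
  have hzC' : ∀ j x, ‖z j x‖ ≤ max (C₁ j) (C₂ j) * Real.exp (-α j * x) := fun j x => by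
    refine (hzC j x).trans ?_
    rw [norm_inv, Real.log_inv, neg_div]
    exact mul_le_mul_of_nonneg_right (le_max_right _ _) (Real.exp_pos _).le
  have hC : ∀ j, 0 ≤ max (C₁ j) (C₂ j) := fun j => (hC₁ j).le.trans (le_max_left _ _)
  have hbd : ∃ K : ℝ, ∀ x i j, ‖A x i j‖ ≤ K := by
    have h1 : ∀ i j, ∃ K, ∀ x, ‖A x i j‖ ≤ K := by
      intro i j
      have hc : Continuous fun x => A x i j := (continuous_apply j).comp
        ((continuous_apply i).comp hA)
      have hp : Function.Periodic (fun x => A x i j) T := fun x => by simp only [hper]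
      obtain ⟨K, hK⟩ := (hp.isBounded_of_continuous hT.ne' hc).exists_norm_le
      exact ⟨K, fun x => hK _ (mem_range_self x)⟩
    choose K hK using h1
    refine ⟨∑ i, ∑ j, |K i j|, fun x i j => ?_⟩
    calc _ ≤ K i j := hK i j x
      _ ≤ |K i j| := le_abs_self _
      _ ≤ ∑ j, |K i j| := Finset.single_le_sum (f := fun j => |K i j|)
          (fun _ _ => abs_nonneg _) (Finset.mem_univ j)
      _ ≤ _ := Finset.single_le_sum (f := fun i => ∑ j, |K i j|)
          (fun _ _ => Finset.sum_nonneg fun _ _ => abs_nonneg _) (Finset.mem_univ i)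
  obtain ⟨K, hK⟩ := hbd
  refine isFredholm_of_opKer_opRange
    (opKer_eq_bot_of_dichotomy hA (fun j => hasDerivAt_adjoint hV htr (q j)) hvz hα hC hzC') ?_
  rw [eq_top_iff]
  intro g _
  exact mem_opRange_of_dichotomy hA hK hvsol hzc hvz hα hC hvC' hzC' g

end Dichotomy

end Floquet

end

-- The classification on the imaginary axis.

theorem theorem1p3
    (A : ℝ → ℂ → Matrix (Fin 4) (Fin 4) ℂ) (T : ℝ) (hT : 0 < T)
    -- the finitely many parameter values at which `A` is allowed to be singular
    (S : Set ℂ) (hS : S.Finite) (hSneg : ∀ lam ∈ S, -lam ∈ S)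
    -- standing regularity: continuous in `(x, lam)`, holomorphic in `lam`
    (hcont : ContinuousOn (fun p : ℝ × ℂ => A p.1 p.2) (Set.univ ×ˢ Sᶜ))
    (hhol : ∀ x i j, DifferentiableOn ℂ (fun lam => A x lam i j) Sᶜ)
    (hper : ∀ x, ∀ lam ∉ S, A (x + T) lam = A x lam)
    -- (A1)
    (hA1 : ∀ x, ∀ r : ℝ, (r : ℂ) ∉ S → ∀ i j, (A x r i j).im = 0)
    -- (A2)
    (hA2 : ∃ B : ℂ → Matrix (Fin 4) (Fin 4) ℂ, {lam | (B lam).det = 0}.Finite ∧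
      ∀ x, ∀ lam ∉ S, (A x lam).transpose * B lam = -(B lam * A x (-lam)))
    (htr : ∀ x, ∀ lam ∉ S, (A x lam).trace = 0)
    -- the fundamental matrix, whose value at `T` is the monodromy matrix
    (V : ℝ → ℂ → Matrix (Fin 4) (Fin 4) ℂ)
    (hV : ∀ lam ∉ S, Floquet.IsFundamentalMatrix (fun x => A x lam) (fun x => V x lam))
    (M : ℂ → Matrix (Fin 4) (Fin 4) ℂ) (hM : ∀ lam, M lam = V T lam)
    (lam : ℂ) (hlamS : lam ∉ S) (hlam : lam.re = 0) :
    (Floquet.unitCircleCount (M lam) = 0 ∨ Floquet.unitCircleCount (M lam) = 2 ∨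
      Floquet.unitCircleCount (M lam) = 4) ∧
    ∃ f₁ f₂ f₃ : ℝ,
      (M lam).trace = (f₁ : ℂ) + Complex.I * (f₂ : ℂ) ∧
      (1 / 2 : ℂ) * ((M lam).trace ^ 2 - (M lam ^ 2).trace) = (f₃ : ℂ) ∧
      (Floquet.Delta4 f₁ f₂ f₃ ≠ 0 → Floquet.P4 f₁ f₂ f₃ ≠ 0 → Floquet.D4 f₁ f₂ f₃ ≠ 0 →
        (0 < Floquet.Delta4 f₁ f₂ f₃ ∧ Floquet.P4 f₁ f₂ f₃ < 0 ∧ Floquet.D4 f₁ f₂ f₃ < 0 →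
          lam ∈ Floquet.essSpectrum A ∧ Floquet.essMultiplicity A T lam = 4) ∧
        (Floquet.Delta4 f₁ f₂ f₃ < 0 →
          lam ∈ Floquet.essSpectrum A ∧ Floquet.essMultiplicity A T lam = 2) ∧
        (0 < Floquet.Delta4 f₁ f₂ f₃ ∧ (0 < Floquet.P4 f₁ f₂ f₃ ∨ 0 < Floquet.D4 f₁ f₂ f₃) →
          lam ∉ Floquet.essSpectrum A ∧ Floquet.essMultiplicity A T lam = 0)) := by
  classical
  have hVlam := hV lam hlamS
  have hc : Continuous fun x => A x lam :=
    hcont.comp_continuous (f := fun x : ℝ => (x, lam)) (by fun_prop) fun x => by simp [hlamS]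
  have htr' : ∀ x, (A x lam).trace = 0 := fun x => htr x lam hlamS
  have hper' : ∀ x, A (x + T) lam = A x lam := fun x => hper x lam hlamS
  have hdet : (M lam).det = 1 := by
    rw [hM]; exact hVlam.det_eq_one htr' T
  have hsymm : (M lam).charpoly.roots.map Floquet.circleReflection = (M lam).charpoly.roots := by
    refine Floquet.map_circleReflection_roots_charpoly hdet fun t => ?_
    rw [hM, ← Floquet.monodromy_neg_eq_conj hS hSneg hhol hA1 htr hV hlamS hlam T]
    exact Floquet.det_scalar_sub_monodromy_neg hT.le hS hSneg hcont hA2 htr hV hlamS t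
  have hcard : (M lam).charpoly.roots.card = 4 := by
    rw [IsAlgClosed.card_roots_eq_natDegree, Matrix.charpoly_natDegree_eq_dim, Fintype.card_fin]
  have hprod : (M lam).charpoly.roots.prod = 1 := by
    rw [← Matrix.det_eq_prod_roots_charpoly, hdet]
  have hcount : Floquet.unitCircleCount (M lam) =
      ((M lam).charpoly.roots.filter fun μ => ‖μ‖ = 1).card := by
    unfold Floquet.unitCircleCount
    congr!
  have hmult : Floquet.essMultiplicity A T lam = Floquet.unitCircleCount (M lam) := by
    rw [hM]
    exact Floquet.essMultiplicity_eq_unitCircleCount (A := A) (V := fun x => V x lam)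
      hVlam htr' hper'
  have hmem : Floquet.unitCircleCount (M lam) ≠ 0 → lam ∈ Floquet.essSpectrum A := fun h => by
    obtain ⟨μ, hμ⟩ := Multiset.card_pos_iff_exists_mem.1 (Nat.pos_of_ne_zero (hcount ▸ h))
    rw [Multiset.mem_filter, hM] at hμ
    exact Floquet.not_isFredholm_of_norm_eq_one hc hVlam htr' hT hper' hμ.1 hμ.2
  obtain ⟨h024, f₁, f₂, f₃, h1, h2, hnodup, hcases⟩ :=
    Floquet.card_circle_classification hsymm hcard hprod
  rw [← hcount] at h024 hcases
  rw [← Matrix.trace_eq_sum_roots_charpoly] at h1 h2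
  rw [← Floquet.trace_sq_eq_sum_sq_roots] at h2
  refine ⟨h024, f₁, f₂, f₃, h1, h2, fun hΔ hP hD => ?_⟩
  obtain ⟨k4, k2, k0⟩ := hcases hΔ hP hD
  refine ⟨fun h => ⟨hmem (by rw [k4 h]; norm_num), hmult.trans (k4 h)⟩,
    fun h => ⟨hmem (by rw [k2 h]; norm_num), hmult.trans (k2 h)⟩,
    fun h => ⟨fun hess => hess ?_, hmult.trans (k0 h)⟩⟩
  -- A nonzero discriminant makes the multipliers simple, so the dichotomy can be built from
  -- eigenvectors alone.
  have hnd := hnodup hΔ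
  have hz := k0 h
  rw [hcount, Multiset.card_eq_zero, Multiset.filter_eq_nil] at hz
  rw [hM] at hnd hz
  exact Floquet.isFredholm_of_nodup hc hVlam htr' hT hper' hnd hz
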